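/- Let $d\in\mathbb N$ and $p\in(1,\infty)$. For $T>0$ and $q\in[1,\infty]$ write $\|f\|_{L^1_tL^q_x}=\int_0^T\|f(t,\cdot)\|_{L^q(\mathbb R^d)}\,dt$ and $\|f\|_{L^1_tL^1(B_\lambda)}=\int_0^T\|f(t,\cdot)\|_{L^1(B_\lambda)}\,dt$, where $B_r\subset\mathbb R^d$ is the ball of radius $r$ centred at $0$. Let $b^1,b^2\colon[0,T]\times\mathbb R^d\to\mathbb R^d$ be Borel, locally integrable, incompressible vector fields (that is, $\operatorname{div} b^i(t,\cdot)=0$ in the sense of distributions for a.e. $t$) such that, for $i=1,2$, $b^i=b^i_1+b^i_2$ a.e., with $b^i_1\in L^1([0,T];L^1(\mathbb R^d))$ and $b^i_2\in L^1([0,T];L^\infty(\mathbb R^d))$, and such that the weak spatial derivatives satisfy $Db^1_1\in L^1([0,T];L^p(\mathbb R^d))$ and $Db^1_2\in L^1([0,T];L^\infty(\mathbb R^d))$. No regularity of the derivatives of $b^2$ is assumed. For $i=1,2$ let $X^i\colon[0,T]^2\times\mathbb R^d\to\mathbb R^d$ be a regular Lagrangian flow of $b^i$, i.e. a Borel map such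 that for every $s\in[0,T]$: (i) for every $t\in[0,T]$ the map $X^i(t,s,\cdot)$ preserves Lebesgue measure; (ii) for a.e. $x$ the map $t\mapsto b^i(t,X^i(t,s,x))$ is in $L^1((0,T))$; (iii) for a.e. $x$ the curve $t\mapsto X^i(t,s,x)$ is absolutely continuous and $X^i(t,s,x)=x+\int_s^t b^i(z,X^i(z,s,x))\,dz$ for all $t\in[0,T]$. For $\delta,R>0$ let $$g_{\delta,R}(t,s)=\int_{B_R}\log\left(\frac{|X^1(t,s,x)-X^2(t,s,x)|}{\delta}+1\right)dx .$$ (1) There are constants $c_{d,p,R}$, depending only on $d,p,R$, and $c_{d,R}$, depending only on $d,R$, such that for all $T>0$ and all fields and flows as above, all $\delta>0$, and all $\lambda>R+\|b^2_2\|_{L^1_tL^\infty_x}$, $$\sup_{t,s\in[0,T]}g_{\delta,R}(t,s)\le c_{d,p,R}\|Db^1_1\|_{L^1_tL^p_x}+c_{d,R}\|Db^1_2\|_{L^1_tL^\infty_x}+\frac1\delta\|b^1_1-b^2_1\|_{L^1_tL^1_x}+\frac1\delta\|b^1_2-b^2_2\|_{L^1_tL^1(B_\lambda)}+\frac1\delta\,\frac{\|b^1_2\|_{L^1_tL^\infty_x}+\|b^2_2\|_{L^1_tL^\infty_x}}{\lambda-R-\|b^2_2\|_{L^1_tL^\infty_x}}\,\|b^2_1\|_{L^1_tL^1_x}.$$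 (2) For all $\varepsilon,R,\eta>0$ and $K\ge0$ there are $C\geq 0$ and $\lambda>0$, depending only on $\eta,\varepsilon,p,d,R,K$, such that for all $T>0$ and all fields and flows as above for which $\|b^i_1\|_{L^1_tL^1_x}$, $\|b^i_2\|_{L^1_tL^\infty_x}$ ($i=1,2$), $\|Db^1_1\|_{L^1_tL^p_x}$ and $\|Db^1_2\|_{L^1_tL^\infty_x}$ are all at most $K$, $$\sup_{t,s\in[0,T]}\mathcal L^d\big(\{x\in B_R:\ |X^1(t,s,x)-X^2(t,s,x)|>\varepsilon\}\big)\le C\left[\|b^1_1-b^2_1\|_{L^1_tL^1_x}+\|b^1_2-b^2_2\|_{L^1_tL^1(B_\lambda)}\right]+\eta .$$ -/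

import Mathlib

open MeasureTheory Set Metric
open scoped ENNReal NNReal ContDiff

/-- The space `ℝ^d` with the Euclidean norm. -/
abbrev Rd (d : ℕ) : Type := EuclideanSpace ℝ (Fin d)

/-- The norm of `L¹([0,T]; L^q(μ))`, with values in `[0,∞]`.  Here `μ` is Lebesgue measure on `ℝ^d`,
or its restriction to a subset of `ℝ^d`. -/
noncomputable def L1LqNorm {d : ℕ} {F : Type*} [NormedAddCommGroup F] (T : ℝ) (q : ℝ≥0∞)
    (μ : Measure (Rd d)) (f : ℝ → Rd d → F) : ℝ≥0∞ :=
  ∫⁻ t in Icc 0 T, eLpNorm (f t) q μ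

/-- `f ∈ L¹([0,T]; L^q(ℝ^d))`. -/
def MemL1Lq {d : ℕ} {F : Type*} [NormedAddCommGroup F] (T : ℝ) (q : ℝ≥0∞)
    (f : ℝ → Rd d → F) : Prop :=
  AEStronglyMeasurable (Function.uncurry f)
      ((volume.restrict (Icc (0 : ℝ) T)).prod (volume : Measure (Rd d))) ∧
    L1LqNorm T q volume f < ⊤

/-- `A` is the weak (distributional) derivative of the vector field `f` on `ℝ^d`, and both are
locally integrable. -/
structure HasWeakFDeriv {d : ℕ} (f : Rd d → Rd d) (A : Rd d → Rd d →L[ℝ] Rd d) : Prop where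
  locallyIntegrable : LocallyIntegrable f
  locallyIntegrable_deriv : LocallyIntegrable A
  integral_eq : ∀ φ : Rd d → ℝ, ContDiff ℝ ∞ φ → HasCompactSupport φ → ∀ v : Rd d,
    ∫ x, φ x • A x v = -∫ x, (fderiv ℝ φ x v) • f x

/-- `u` is a Borel vector field, locally integrable on `[0,T] × ℝ^d`, which is incompressible:
for a.e. `t ∈ [0,T]`, `div u(t, ·) = 0` in the sense of distributions on `ℝ^d`.
Only the values of `u` for times in `[0,T]` matter; a Borel field on `[0,T] × ℝ^d` is regarded as
a Borel function on `ℝ × ℝ^d`, for instance through its extension by zero. -/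
structure IsIncompressibleField {d : ℕ} (T : ℝ) (u : ℝ → Rd d → Rd d) : Prop where
  measurable : Measurable (Function.uncurry u)
  locallyIntegrable :
    LocallyIntegrableOn (Function.uncurry u) (Icc (0 : ℝ) T ×ˢ (univ : Set (Rd d)))
  div_eq_zero : ∀ᵐ t ∂(volume.restrict (Icc (0 : ℝ) T)),
    ∀ φ : Rd d → ℝ, ContDiff ℝ ∞ φ → HasCompactSupport φ →
      ∫ x, fderiv ℝ φ x (u t x) = 0

/-- `X` is a (complete) regular Lagrangian flow of `u` on `[0,T]`; `X t s x` is the position at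
time `t` of the trajectory which is at `x` at time `s`. -/
structure IsRegularLagrangianFlow {d : ℕ} (T : ℝ) (u : ℝ → Rd d → Rd d)
    (X : ℝ → ℝ → Rd d → Rd d) : Prop where
  measurable : Measurable fun z : ℝ × ℝ × Rd d => X z.1 z.2.1 z.2.2
  measurePreserving : ∀ s ∈ Icc 0 T, ∀ t ∈ Icc 0 T, MeasurePreserving (X t s) volume volume
  integrable : ∀ s ∈ Icc 0 T, ∀ᵐ x, IntegrableOn (fun t => u t (X t s x)) (Ioo 0 T)
  absolutelyContinuous : ∀ s ∈ Icc 0 T, ∀ᵐ x,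
    AbsolutelyContinuousOnInterval (fun t => X t s x) 0 T
  integral_eq : ∀ s ∈ Icc 0 T, ∀ᵐ x, ∀ t ∈ Icc 0 T,
    X t s x = x + ∫ z in s..t, u z (X z s x)

/-- The assumptions on two vector fields `b¹ = b¹₁ + b¹₂` and `b² = b²₁ + b²₂` (written
`b1 = b11 + b12`, `b2 = b21 + b22`) and their flows: `D11`, `D12` are the spatial weak derivatives
of `b11`, `b12`. No differentiability is required of `b2`. -/
structure IsFlowPair {d : ℕ} (p : ℝ≥0∞) (T : ℝ)
    (b1 b11 b12 b2 b21 b22 : ℝ → Rd d → Rd d) (D11 D12 : ℝ → Rd d → Rd d →L[ℝ] Rd d)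
    (X1 X2 : ℝ → ℝ → Rd d → Rd d) : Prop where
  incompressible_b1 : IsIncompressibleField T b1
  incompressible_b2 : IsIncompressibleField T b2
  b1_eq : ∀ᵐ z ∂((volume.restrict (Icc (0 : ℝ) T)).prod (volume : Measure (Rd d))),
    b1 z.1 z.2 = b11 z.1 z.2 + b12 z.1 z.2
  b2_eq : ∀ᵐ z ∂((volume.restrict (Icc (0 : ℝ) T)).prod (volume : Measure (Rd d))),
    b2 z.1 z.2 = b21 z.1 z.2 + b22 z.1 z.2
  mem_b11 : MemL1Lq T 1 b11
  mem_b12 : MemL1Lq T ⊤ b12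
  mem_b21 : MemL1Lq T 1 b21
  mem_b22 : MemL1Lq T ⊤ b22
  hasWeakFDeriv_b11 : ∀ᵐ t ∂(volume.restrict (Icc (0 : ℝ) T)), HasWeakFDeriv (b11 t) (D11 t)
  hasWeakFDeriv_b12 : ∀ᵐ t ∂(volume.restrict (Icc (0 : ℝ) T)), HasWeakFDeriv (b12 t) (D12 t)
  mem_D11 : MemL1Lq T p D11
  mem_D12 : MemL1Lq T ⊤ D12
  flow_X1 : IsRegularLagrangianFlow T b1 X1
  flow_X2 : IsRegularLagrangianFlow T b2 X2

/-- The functional `g_{δ,R}(t,s) = ∫_{B_R} log(|X¹(t,s,x) - X²(t,s,x)| / δ + 1) dx`, the integral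
of a nonnegative function, with values in `[0,∞]`. -/
noncomputable def logFunctional {d : ℕ} (δ R : ℝ) (X1 X2 : ℝ → ℝ → Rd d → Rd d) (t s : ℝ) :
    ℝ≥0∞ :=
  ∫⁻ x in ball (0 : Rd d) R, ENNReal.ofReal (Real.log (‖X1 t s x - X2 t s x‖ / δ + 1))

/-! The argument is the Crippa–De Lellis logarithmic estimate, arranged so that only the first field
needs derivatives. For a.e. `x` the curves `X1 τ s x` and `X2 τ s x` agree at `τ = s`, so `log (|X1
- X2| / δ + 1)` starts from zero and grows at rate at most `|b1(X1) - b2(X2)| / (|X1 - X2| + δ)`.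
Write `b1(X1) - b2(X2) = (b1(X1) - b1(X2)) + (b1 - b2)(X2)`.

For the first bracket, a Sobolev map satisfies `|f x - f y| ≤ C |x - y| (M x + M y)` off a null set,
where `M` is the maximal function of `|Df|`. The denominator absorbs `|x - y|`. Since both flows
preserve Lebesgue measure, `M(X1)` and `M(X2)` integrate over `B_R` to a constant times the `L^p`
norm of the derivative, by Hölder and the strong `(p,p)` maximal inequality. For a bounded
derivative, `M` is bounded by its essential supremum. These terms carry no power of `δ`.

The second bracket costs `1/δ`. Its integrable part is a change of variables along `X2`. Its bounded
part is integrated in `L^1` over the points with `X2` in `B_λ`, and bounded in sup norm on the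
points that have left `B_λ`. The latter set is small by Chebyshev: `b22` moves a point by at most
its `L^1 L^∞` norm, so the remaining displacement must come from `b21`, whose integral along
trajectories has mean controlled by its `L^1` norm.

Stability in measure follows by Markov's inequality: dividing by `log (ε / δ + 1)` makes the
derivative terms small once `δ` is small, and then a large `λ` makes the exit term small. -/

/-! ### The Hardy–Littlewood maximal function and its weak type estimate -/

section MaximalFunction

variable {E : Type*} [NormedAddCommGroup E] [MeasurableSpace E]

/-- The uncentred Hardy–Littlewood maximal function. -/
noncomputable def maximalFunction (μ : Measure E) (g : E → ℝ≥0∞) (x : E) : ℝ≥0∞ :=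
  ⨆ (c : E) (r : ℝ) (_ : x ∈ ball c r), (∫⁻ y in ball c r, g y ∂μ) / μ (ball c r)

theorem lintegral_ball_div_le_maximalFunction (μ : Measure E) (g : E → ℝ≥0∞) {x c : E} {r : ℝ}
    (h : x ∈ ball c r) :
    (∫⁻ y in ball c r, g y ∂μ) / μ (ball c r) ≤ maximalFunction μ g x :=
  le_iSup_of_le c <| le_iSup_of_le r <| le_iSup_of_le h le_rfl

/-- With uncentred balls, a superlevel set is a union of open balls. It is therefore open, whatever
`g` is, and directly accessible to a covering argument. -/
theorem setOf_lt_maximalFunction (μ : Measure E) (g : E → ℝ≥0∞) (a : ℝ≥0∞) :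
    {x | a < maximalFunction μ g x} =
      ⋃ q ∈ {q : E × ℝ | a < (∫⁻ y in ball q.1 q.2, g y ∂μ) / μ (ball q.1 q.2)},
        ball q.1 q.2 := by
  ext x
  simp only [maximalFunction, mem_ofPred_eq, lt_iSup_iff, mem_iUnion, Prod.exists]
  tauto

theorem isOpen_setOf_lt_maximalFunction (μ : Measure E) (g : E → ℝ≥0∞) (a : ℝ≥0∞) :
    IsOpen {x | a < maximalFunction μ g x} := by
  rw [setOf_lt_maximalFunction]
  exact isOpen_biUnion fun _ _ => isOpen_ball

theorem measurable_maximalFunction [BorelSpace E] (μ : Measure E) (g : E → ℝ≥0∞) :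
    Measurable (maximalFunction μ g) :=
  measurable_of_Ioi fun a => (isOpen_setOf_lt_maximalFunction μ g a).measurableSet

theorem maximalFunction_congr_ae {μ : Measure E} {g h : E → ℝ≥0∞} (hgh : g =ᵐ[μ] h) :
    maximalFunction μ g = maximalFunction μ h := by
  ext x
  simp only [maximalFunction]
  refine iSup_congr fun c => iSup_congr fun r => iSup_congr fun _ => ?_
  rw [lintegral_congr_ae (ae_restrict_of_ae hgh)]

theorem maximalFunction_le_of_ae_le (μ : Measure E) {g : E → ℝ≥0∞}
    {a : ℝ≥0∞} (h : ∀ᵐ x ∂μ, g x ≤ a) (x : E) : maximalFunction μ g x ≤ a := by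
  refine iSup_le fun c => iSup_le fun r => iSup_le fun _ => ENNReal.div_le_of_le_mul ?_
  calc ∫⁻ y in ball c r, g y ∂μ ≤ ∫⁻ _ in ball c r, a ∂μ :=
        lintegral_mono_ae (ae_restrict_of_ae h)
    _ = a * μ (ball c r) := by simp

variable [NormedSpace ℝ E] [FiniteDimensional ℝ E]

theorem lintegral_ball_le_measure_mul_maximalFunction (μ : Measure E) [μ.IsAddHaarMeasure]
    (g : E → ℝ≥0∞) {x c : E} {r : ℝ} (h : x ∈ ball c r) :
    ∫⁻ y in ball c r, g y ∂μ ≤ μ (ball c r) * maximalFunction μ g x := by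
  have h0 : μ (ball c r) ≠ 0 := (measure_ball_pos μ c (pos_of_mem_ball h)).ne'
  rw [mul_comm, ← ENNReal.div_le_iff h0 measure_ball_lt_top.ne]
  exact lintegral_ball_div_le_maximalFunction μ g h

variable [BorelSpace E]

/-- Vitali covering: disjoint balls whose enlargements cover the union lose only the dilation
factor, and the integrals of `g` over disjoint balls add up to at most the full integral. The bound
`N` on the radii is what Vitali's selection needs. -/
theorem mul_measure_biUnion_ball_le (μ : Measure E) [μ.IsAddHaarMeasure] (g : E → ℝ≥0∞)
    {a : ℝ≥0∞} {S : Set (E × ℝ)} {N : ℝ} (hN : ∀ q ∈ S, q.2 ≤ N)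
    (hS : ∀ q ∈ S, a * μ (ball q.1 q.2) ≤ ∫⁻ y in ball q.1 q.2, g y ∂μ) :
    a * μ (⋃ q ∈ S, ball q.1 q.2) ≤
      ENNReal.ofReal (4 ^ Module.finrank ℝ E) * ∫⁻ y, g y ∂μ := by
  -- Only balls of positive radius are kept: a disjoint family of nonempty open sets is countable.
  -- The dilation factor must exceed 3; 4 is used.
  set S' := {q ∈ S | 0 < q.2}
  obtain ⟨u, huS, hdisj, hcov⟩ := Vitali.exists_disjoint_subfamily_covering_enlargement_ball
    S' (fun q => q.1) (fun q => q.2) N (fun q hq => hN q hq.1) 4 (by norm_num)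
  have hu : u.Countable := hdisj.countable_of_isOpen (fun _ _ => isOpen_ball)
    fun q hq => nonempty_ball.2 (huS hq).2
  have hsub : (⋃ q ∈ S, ball q.1 q.2) ⊆ ⋃ q ∈ u, ball q.1 (4 * q.2) := by
    refine iUnion₂_subset fun q hq x hx => ?_
    obtain ⟨b, hb, hb'⟩ := hcov q ⟨hq, pos_of_mem_ball hx⟩
    exact mem_biUnion hb (hb' hx)
  calc a * μ (⋃ q ∈ S, ball q.1 q.2)
      ≤ a * ∑' q : u, μ (ball q.1.1 (4 * q.1.2)) := by
        gcongr
        exact (measure_mono hsub).trans (measure_biUnion_le μ hu _)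
    _ = ENNReal.ofReal (4 ^ Module.finrank ℝ E) * ∑' q : u, a * μ (ball q.1.1 q.1.2) := by
        rw [← ENNReal.tsum_mul_left, ← ENNReal.tsum_mul_left]
        refine tsum_congr fun q => ?_
        rw [Measure.addHaar_ball_mul_of_pos μ _ (by norm_num), ← Measure.addHaar_ball_center μ q.1.1]
        ring
    _ ≤ ENNReal.ofReal (4 ^ Module.finrank ℝ E) *
          ∑' q : u, ∫⁻ y in ball q.1.1 q.1.2, g y ∂μ := by
        gcongr with q
        exact hS _ (huS q.2).1
    _ = ENNReal.ofReal (4 ^ Module.finrank ℝ E) * ∫⁻ y in ⋃ q ∈ u, ball q.1 q.2, g y ∂μ := by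
        rw [lintegral_biUnion hu (fun _ _ => measurableSet_ball) hdisj]
    _ ≤ _ := by
        exact mul_le_mul_right (setLIntegral_le_lintegral _ _) _

/-- The weak type `(1,1)` estimate for the maximal function. -/
theorem mul_measure_lt_maximalFunction_le (μ : Measure E) [μ.IsAddHaarMeasure] (g : E → ℝ≥0∞)
    (a : ℝ≥0∞) :
    a * μ {x | a < maximalFunction μ g x} ≤
      ENNReal.ofReal (4 ^ Module.finrank ℝ E) * ∫⁻ y, g y ∂μ := by
  set S := {q : E × ℝ | a < (∫⁻ y in ball q.1 q.2, g y ∂μ) / μ (ball q.1 q.2)} with hSdef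
  -- Exhausting by balls of radius at most `n` supplies the radius bound, and continuity from below
  -- removes it.
  have hU : (⋃ q ∈ S, ball q.1 q.2) = ⋃ n : ℕ, ⋃ q ∈ S ∩ {q | q.2 ≤ n}, ball q.1 q.2 := by
    ext x
    simp only [mem_iUnion, mem_inter_iff, exists_prop]
    constructor
    · rintro ⟨q, hq, hx⟩
      obtain ⟨n, hn⟩ := exists_nat_ge q.2
      exact ⟨n, q, ⟨hq, hn⟩, hx⟩
    · rintro ⟨n, q, ⟨hq, -⟩, hx⟩
      exact ⟨q, hq, hx⟩
  have hmono : Monotone fun n : ℕ => ⋃ q ∈ S ∩ {q | q.2 ≤ n}, ball q.1 q.2 := by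
    intro m n hmn
    refine biUnion_subset_biUnion_left fun q hq => ⟨hq.1, le_trans (mem_ofPred.1 hq.2) ?_⟩
    exact_mod_cast hmn
  rw [setOf_lt_maximalFunction, ← hSdef, hU, hmono.measure_iUnion, ENNReal.mul_iSup]
  refine iSup_le fun n => mul_measure_biUnion_ball_le μ g (fun q hq => hq.2) fun q hq => ?_
  exact ENNReal.mul_le_of_le_div hq.1.le

/-- Truncation at height `t / 2`: values of `g` up to `t / 2` contribute at most `t / 2` to any
average, so the part of `g` above that height must have maximal function exceeding `t / 2`. The weak
type estimate applies to that part alone. -/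
theorem measure_lt_maximalFunction_le_setLIntegral (μ : Measure E) [μ.IsAddHaarMeasure]
    {g : E → ℝ≥0∞} (hg : Measurable g) {t : ℝ} (ht : 0 < t) :
    μ {x | ENNReal.ofReal t < maximalFunction μ g x} ≤
      ENNReal.ofReal (2 * 4 ^ Module.finrank ℝ E) * (ENNReal.ofReal t)⁻¹ *
        ∫⁻ y in {y | ENNReal.ofReal t < 2 * g y}, g y ∂μ := by
  set A := {y | ENNReal.ofReal t < 2 * g y} with hA
  have hAm : MeasurableSet A := measurableSet_lt measurable_const (hg.const_mul 2)
  set s := ENNReal.ofReal (t / 2) with hs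
  have hs0 : s ≠ 0 := by simpa [hs] using ht
  have hst : ENNReal.ofReal t = s + s := by
    rw [hs, ← ENNReal.ofReal_add (by positivity) (by positivity)]; ring_nf
  have hgle : ∀ y, g y ≤ A.indicator g y + s := by
    intro y
    by_cases hy : y ∈ A
    · simp [hy]
    · simp only [hy, not_false_eq_true, indicator_of_notMem, zero_add]
      simp only [hA, mem_ofPred_eq, not_lt, hst, two_mul] at hy
      by_contra! h
      exact (ENNReal.add_lt_add h h).not_ge hy
  have hsub : {x | ENNReal.ofReal t < maximalFunction μ g x} ⊆
      {x | s < maximalFunction μ (A.indicator g) x} := by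
    intro x hx
    simp only [maximalFunction, mem_ofPred_eq, lt_iSup_iff] at hx ⊢
    obtain ⟨c, r, hxc, h⟩ := hx
    refine ⟨c, r, hxc, ?_⟩
    have h0 : μ (ball c r) ≠ 0 := (measure_ball_pos μ c (pos_of_mem_ball hxc)).ne'
    have : (∫⁻ y in ball c r, g y ∂μ) / μ (ball c r) ≤
        (∫⁻ y in ball c r, A.indicator g y ∂μ) / μ (ball c r) + s := by
      calc _ ≤ (∫⁻ y in ball c r, (A.indicator g y + s) ∂μ) / μ (ball c r) := by
            gcongr with y; exact hgle y
        _ = _ := by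
            rw [lintegral_add_right _ measurable_const, ENNReal.add_div]
            simp only [lintegral_const, MeasurableSet.univ, Measure.restrict_apply, univ_inter]
            rw [ENNReal.mul_div_cancel_right h0 measure_ball_lt_top.ne]
    rw [hst] at h
    exact lt_of_add_lt_add_right (h.trans_le this)
  have hweak := mul_measure_lt_maximalFunction_le μ (A.indicator g) s
  rw [lintegral_indicator hAm] at hweak
  have h2 : (ENNReal.ofReal t)⁻¹ * 2 = s⁻¹ := by
    rw [hst, ← mul_two, ENNReal.mul_inv (by simp) (by simp), mul_assoc,
      ENNReal.inv_mul_cancel (by simp) (by simp), mul_one]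
  calc μ {x | ENNReal.ofReal t < maximalFunction μ g x}
      ≤ μ {x | s < maximalFunction μ (A.indicator g) x} := measure_mono hsub
    _ ≤ s⁻¹ * (ENNReal.ofReal (4 ^ Module.finrank ℝ E) * ∫⁻ y in A, g y ∂μ) := by
        rw [mul_comm s⁻¹, ← div_eq_mul_inv, ENNReal.le_div_iff_mul_le (.inl hs0) (.inl (by simp [hs])),
          mul_comm]
        exact hweak
    _ = _ := by
        rw [← h2, ENNReal.ofReal_mul (by norm_num), ENNReal.ofReal_ofNat]
        ring

end MaximalFunction

/-! ### Layer cake formula and the strong type estimate -/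

theorem ENNReal.rpow_eq_lintegral {p : ℝ} (hp : 0 < p) (a : ℝ≥0∞) :
    a ^ p = ENNReal.ofReal p *
      ∫⁻ t in Ioi (0 : ℝ), {t | ENNReal.ofReal t < a}.indicator
        (fun t => ENNReal.ofReal (t ^ (p - 1))) t := by
  have key : ∀ b : ℝ, 0 ≤ b → ENNReal.ofReal b ^ p = ENNReal.ofReal p *
      ∫⁻ t in Ioi (0 : ℝ), {t | ENNReal.ofReal t < ENNReal.ofReal b}.indicator
        (fun t => ENNReal.ofReal (t ^ (p - 1))) t := by
    intro b hb
    -- The layer cake formula for a constant function under a Dirac mass is the formula for a single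
    -- number.
    have := lintegral_rpow_eq_lintegral_meas_lt_mul (Measure.dirac ()) (f := fun _ => b)
      (Filter.Eventually.of_forall fun _ => hb) measurable_const.aemeasurable hp
    rw [lintegral_dirac, ← ENNReal.ofReal_rpow_of_nonneg hb hp.le] at this
    rw [this]
    congr 1
    refine setLIntegral_congr_fun measurableSet_Ioi fun t ht => ?_
    have : ENNReal.ofReal t < ENNReal.ofReal b ↔ t < b := by
      rw [ENNReal.ofReal_lt_ofReal_iff_of_nonneg (le_of_lt ht)]
    by_cases h : t < b <;> simp [h, this, indicator]
  induction a with
  | coe a => simpa using key a a.2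
  | top =>
    rw [ENNReal.top_rpow_of_pos hp]
    symm
    -- The right side is monotone in `a`, so its value at `⊤` dominates the value `r` attained at `r
    -- ^ p⁻¹`, for every `r`.
    refine ENNReal.eq_top_of_forall_nnreal_le fun r => ?_
    have h1 := key ((r : ℝ) ^ p⁻¹) (by positivity)
    rw [ENNReal.ofReal_rpow_of_nonneg (by positivity) hp.le, ← Real.rpow_mul r.coe_nonneg,
      inv_mul_cancel₀ hp.ne', Real.rpow_one, ENNReal.ofReal_coe_nnreal] at h1
    rw [h1]
    gcongr
    exact le_top

theorem lintegral_rpow_eq_lintegral_meas_lt {α : Type*} [MeasurableSpace α] (μ : Measure α)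
    [SFinite μ] {f : α → ℝ≥0∞} (hf : Measurable f) {p : ℝ} (hp : 0 < p) :
    ∫⁻ x, f x ^ p ∂μ = ENNReal.ofReal p *
      ∫⁻ t in Ioi (0 : ℝ), μ {x | ENNReal.ofReal t < f x} * ENNReal.ofReal (t ^ (p - 1)) := by
  simp_rw [ENNReal.rpow_eq_lintegral hp (f _)]
  have hm : Measurable fun z : α × ℝ => {t | ENNReal.ofReal t < f z.1}.indicator
        (fun t => ENNReal.ofReal (t ^ (p - 1))) z.2 := by
    have hs : MeasurableSet {z : α × ℝ | ENNReal.ofReal z.2 < f z.1} :=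
      measurableSet_lt (ENNReal.measurable_ofReal.comp measurable_snd) (hf.comp measurable_fst)
    have : Measurable fun z : α × ℝ => ENNReal.ofReal (z.2 ^ (p - 1)) := by fun_prop
    exact this.indicator hs
  rw [lintegral_const_mul _ hm.lintegral_prod_right', lintegral_lintegral_swap hm.aemeasurable]
  congr 1
  refine lintegral_congr fun t => ?_
  have hs : MeasurableSet {x | ENNReal.ofReal t < f x} := measurableSet_lt measurable_const hf
  calc _ = ∫⁻ x, {x | ENNReal.ofReal t < f x}.indicator
            (fun _ => ENNReal.ofReal (t ^ (p - 1))) x ∂μ := by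
          refine lintegral_congr fun x => ?_
          simp [indicator]
    _ = _ := by rw [lintegral_indicator_const hs, mul_comm]

/-- The strong type `(p,p)` estimate for the maximal function, `1 < p < ∞`. -/
theorem exists_lintegral_maximalFunction_rpow_le {E : Type*} [NormedAddCommGroup E]
    [MeasurableSpace E] [NormedSpace ℝ E] [FiniteDimensional ℝ E] [BorelSpace E] (μ : Measure E)
    [μ.IsAddHaarMeasure] {p : ℝ} (hp : 1 < p) :
    ∃ C : ℝ≥0, ∀ g : E → ℝ≥0∞, AEMeasurable g μ →
      ∫⁻ x, maximalFunction μ g x ^ p ∂μ ≤ C * ∫⁻ x, g x ^ p ∂μ := by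
  set K := ENNReal.ofReal (2 * 4 ^ Module.finrank ℝ E) with hK
  have hp1 : 0 < p - 1 := by linarith
  have h2 : (2 : ℝ≥0∞) ^ (p - 1) ≠ ⊤ := ENNReal.rpow_ne_top_of_nonneg hp1.le (by simp)
  set C := ENNReal.ofReal p * K * (ENNReal.ofReal (p - 1))⁻¹ * 2 ^ (p - 1) with hC
  have hp1' : ENNReal.ofReal (p - 1) ≠ 0 := by simpa using hp
  have hCtop : C ≠ ⊤ := by
    refine ENNReal.mul_ne_top (ENNReal.mul_ne_top (ENNReal.mul_ne_top ?_ ?_) ?_) h2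
    · simp
    · exact ENNReal.ofReal_ne_top
    · simpa using hp
  refine ⟨C.toNNReal, fun g' hg' => ?_⟩
  rw [ENNReal.coe_toNNReal hCtop]
  obtain ⟨g, hg, hgg⟩ := hg'
  rw [maximalFunction_congr_ae hgg,
    show ∫⁻ x, g' x ^ p ∂μ = ∫⁻ x, g x ^ p ∂μ from
      lintegral_congr_ae (hgg.mono fun x hx => by simp only [hx])]
  -- Against the measure with density `g`, the truncated integrals are measures of superlevel sets
  -- of `2 * g`. The extra factor `t⁻¹` lowers the exponent, so a second layer cake, at `p - 1`,
  -- gives `∫ g * (2 * g) ^ (p - 1)`.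
  set ν := μ.withDensity g
  have hset : ∀ t : ℝ, MeasurableSet {y | ENNReal.ofReal t < 2 * g y} := fun t =>
    measurableSet_lt measurable_const (hg.const_mul 2)
  have hν : ∫⁻ x, (2 * g x) ^ (p - 1) ∂ν = 2 ^ (p - 1) * ∫⁻ x, g x ^ p ∂μ := by
    rw [lintegral_withDensity_eq_lintegral_mul _ hg (by fun_prop),
      ← lintegral_const_mul _ (by fun_prop)]
    refine lintegral_congr fun x => ?_
    rw [Pi.mul_apply, ENNReal.mul_rpow_of_nonneg _ _ hp1.le]
    have : g x ^ p = g x ^ (1 : ℝ) * g x ^ (p - 1) := by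
      rw [← ENNReal.rpow_add_of_nonneg _ _ zero_le_one hp1.le]; ring_nf
    rw [this, ENNReal.rpow_one]; ring
  have hlc := lintegral_rpow_eq_lintegral_meas_lt ν (hg.const_mul 2) hp1
  calc ∫⁻ x, maximalFunction μ g x ^ p ∂μ
      = ENNReal.ofReal p * ∫⁻ t in Ioi (0 : ℝ),
          μ {x | ENNReal.ofReal t < maximalFunction μ g x} * ENNReal.ofReal (t ^ (p - 1)) :=
        lintegral_rpow_eq_lintegral_meas_lt μ (measurable_maximalFunction μ g) (by linarith)
    _ ≤ ENNReal.ofReal p * ∫⁻ t in Ioi (0 : ℝ),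
          K * (ν {x | ENNReal.ofReal t < 2 * g x} * ENNReal.ofReal (t ^ (p - 1 - 1))) := by
        gcongr 1
        refine setLIntegral_mono' measurableSet_Ioi fun t (ht : 0 < t) => ?_
        have h0 : ENNReal.ofReal t ≠ 0 := by simpa using ht
        calc _ ≤ (K * (ENNReal.ofReal t)⁻¹ * ∫⁻ y in {y | ENNReal.ofReal t < 2 * g y}, g y ∂μ)
              * ENNReal.ofReal (t ^ (p - 1)) := by
              gcongr
              exact measure_lt_maximalFunction_le_setLIntegral μ hg ht
          _ = K * (ν {x | ENNReal.ofReal t < 2 * g x} *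
                ((ENNReal.ofReal t)⁻¹ * ENNReal.ofReal (t ^ (p - 1)))) := by
              rw [withDensity_apply _ (hset t)]; ring
          _ = _ := by
              rw [Real.rpow_sub_one ht.ne' (p - 1), div_eq_mul_inv, mul_comm (t ^ (p - 1)),
                ENNReal.ofReal_mul (by positivity), ENNReal.ofReal_inv_of_pos ht]
    _ = C * ∫⁻ x, g x ^ p ∂μ := by
        rw [lintegral_const_mul' _ _ ENNReal.ofReal_ne_top]
        rw [hν] at hlc
        have : ∫⁻ t in Ioi (0 : ℝ), ν {x | ENNReal.ofReal t < 2 * g x} *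
            ENNReal.ofReal (t ^ (p - 1 - 1)) =
            (ENNReal.ofReal (p - 1))⁻¹ * (2 ^ (p - 1) * ∫⁻ x, g x ^ p ∂μ) := by
          rw [hlc, ← mul_assoc, ENNReal.inv_mul_cancel hp1' (by simp), one_mul]
        rw [this, hC]; ring

/-! ### Lipschitz estimates for smooth maps by the maximal function -/

theorem enorm_sub_le_mul_lintegral_segment {E F : Type*} [NormedAddCommGroup E]
    [NormedSpace ℝ E] [NormedAddCommGroup F] [NormedSpace ℝ F] {u : E → F}
    (hu : ContDiff ℝ 1 u) (x z : E) :
    ‖u z - u x‖ₑ ≤ ‖z - x‖ₑ * ∫⁻ θ in Ioo (0 : ℝ) 1, ‖fderiv ℝ u (x + θ • (z - x))‖ₑ := by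
  have hcont : Continuous fun θ : ℝ => ‖fderiv ℝ u (x + θ • (z - x))‖ := by
    have := hu.continuous_fderiv one_ne_zero
    fun_prop
  have hd : ∀ θ : ℝ, HasDerivAt (fun θ : ℝ => u (x + θ • (z - x)))
      (fderiv ℝ u (x + θ • (z - x)) (z - x)) θ := by
    intro θ
    have h1 : HasDerivAt (fun θ : ℝ => x + θ • (z - x)) (z - x) θ := by
      simpa using ((hasDerivAt_id θ).smul_const (z - x)).const_add x
    exact ((hu.differentiable one_ne_zero _).hasFDerivAt).comp_hasDerivAt θ h1
  have := norm_sub_le_integral_of_norm_deriv_le_of_le (f := fun θ : ℝ => u (x + θ • (z - x)))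
    (B := fun θ => ‖z - x‖ * ‖fderiv ℝ u (x + θ • (z - x))‖) zero_le_one
    (fun θ _ => (hd θ).continuousAt.continuousWithinAt)
    (fun θ _ => (hd θ).differentiableAt.differentiableWithinAt)
    (Filter.Eventually.of_forall fun θ _ => by
      rw [(hd θ).deriv, mul_comm]; exact ContinuousLinearMap.le_opNorm _ _)
    ((continuous_const.mul hcont).intervalIntegrable _ _)
  simp only [one_smul, zero_smul, add_zero, add_sub_cancel] at this
  rw [intervalIntegral.integral_const_mul, intervalIntegral.integral_of_le zero_le_one] at this
  have hint : IntegrableOn (fun θ : ℝ => ‖fderiv ℝ u (x + θ • (z - x))‖) (Ioc 0 1) :=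
    (hcont.integrableOn_Icc (a := 0) (b := 1)).mono_set Ioc_subset_Icc_self
  calc ‖u z - u x‖ₑ = ENNReal.ofReal ‖u z - u x‖ := (ofReal_norm _).symm
    _ ≤ ENNReal.ofReal (‖z - x‖ * ∫ θ in Ioc (0 : ℝ) 1, ‖fderiv ℝ u (x + θ • (z - x))‖) :=
        ENNReal.ofReal_le_ofReal this
    _ = _ := by
        rw [ENNReal.ofReal_mul (norm_nonneg _), ofReal_norm,
          ofReal_integral_eq_lintegral_ofReal hint
            (Filter.Eventually.of_forall fun _ => norm_nonneg _), restrict_Ioo_eq_restrict_Ioc]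
        simp_rw [ofReal_norm]

section RadialAverages

variable {E F : Type*} [NormedAddCommGroup E] [NormedSpace ℝ E] [FiniteDimensional ℝ E]
  [MeasurableSpace E] [BorelSpace E] [NormedAddCommGroup F] [NormedSpace ℝ F]

/-- The homothety carries the ball of radius `r` to the one of radius `θ * r`, and its Jacobian
cancels the ratio of the volumes. The bound is thus uniform in `θ`, which permits integration along
segments. -/
theorem lintegral_ball_comp_homothety_le (μ : Measure E) [μ.IsAddHaarMeasure] {g : E → ℝ≥0∞}
    (hg : Measurable g) (x : E) {r θ : ℝ} (hr : 0 < r) (hθ : 0 < θ) :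
    ∫⁻ z in ball x r, g (x + θ • (z - x)) ∂μ ≤ μ (ball x r) * maximalFunction μ g x := by
  set G := (ball x (θ * r)).indicator g with hG
  have hGm : Measurable G := hg.indicator measurableSet_ball
  have h1 : ∀ z, (ball x r).indicator (fun z => g (x + θ • (z - x))) z = G (x + θ • (z - x)) := by
    intro z
    have : x + θ • (z - x) ∈ ball x (θ * r) ↔ z ∈ ball x r := by
      simp only [mem_ball, dist_eq_norm, add_sub_cancel_left, norm_smul, Real.norm_of_nonneg hθ.le]
      exact mul_lt_mul_iff_right₀ hθ
    by_cases hz : z ∈ ball x r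
    · rw [hG, indicator_of_mem hz, indicator_of_mem (this.2 hz)]
    · rw [hG, indicator_of_notMem hz, indicator_of_notMem (fun h => hz (this.1 h))]
  have hpos : 0 < θ ^ Module.finrank ℝ E := by positivity
  calc ∫⁻ z in ball x r, g (x + θ • (z - x)) ∂μ
      = ∫⁻ z, G (x + θ • (z - x)) ∂μ := by
        rw [← lintegral_indicator measurableSet_ball, lintegral_congr h1]
    _ = ∫⁻ w, G (x + θ • w) ∂μ := lintegral_sub_right_eq_self (fun w => G (x + θ • w)) x
    _ = ∫⁻ v, G (x + v) ∂(Measure.map (θ • ·) μ) := by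
        rw [lintegral_map (by fun_prop) (measurable_const_smul θ)]
    _ = ENNReal.ofReal (θ ^ Module.finrank ℝ E)⁻¹ * ∫⁻ y in ball x (θ * r), g y ∂μ := by
        rw [Measure.map_addHaar_smul μ hθ.ne', lintegral_smul_measure,
          lintegral_add_left_eq_self G x, abs_of_pos (by positivity),
          lintegral_indicator measurableSet_ball, smul_eq_mul]
    _ ≤ ENNReal.ofReal (θ ^ Module.finrank ℝ E)⁻¹ *
          (μ (ball x (θ * r)) * maximalFunction μ g x) := by
        gcongr
        exact lintegral_ball_le_measure_mul_maximalFunction μ g (mem_ball_self (by positivity))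
    _ = μ (ball x r) * maximalFunction μ g x := by
        rw [Measure.addHaar_ball_mul_of_pos μ x hθ, Measure.addHaar_ball_center μ x r, ← mul_assoc,
          ← mul_assoc, ← ENNReal.ofReal_mul (by positivity), inv_mul_cancel₀ hpos.ne',
          ENNReal.ofReal_one, one_mul]

theorem lintegral_ball_enorm_sub_le (μ : Measure E) [μ.IsAddHaarMeasure] {u : E → F}
    (hu : ContDiff ℝ 1 u) (x : E) {r : ℝ} (hr : 0 < r) :
    ∫⁻ z in ball x r, ‖u z - u x‖ₑ ∂μ ≤
      ENNReal.ofReal r * (μ (ball x r) * maximalFunction μ (fun y => ‖fderiv ℝ u y‖ₑ) x) := by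
  have hfd := hu.continuous_fderiv one_ne_zero
  have hm : Measurable fun q : E × ℝ => ‖fderiv ℝ u (x + q.2 • (q.1 - x))‖ₑ :=
    Continuous.measurable (by fun_prop)
  calc ∫⁻ z in ball x r, ‖u z - u x‖ₑ ∂μ
      ≤ ∫⁻ z in ball x r, ENNReal.ofReal r *
          (∫⁻ θ in Ioo (0 : ℝ) 1, ‖fderiv ℝ u (x + θ • (z - x))‖ₑ) ∂μ := by
        refine setLIntegral_mono' measurableSet_ball fun z hz => ?_
        refine (enorm_sub_le_mul_lintegral_segment hu x z).trans ?_
        gcongr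
        rw [← ofReal_norm, ← dist_eq_norm]
        exact ENNReal.ofReal_le_ofReal (mem_ball.1 hz).le
    _ = ENNReal.ofReal r * ∫⁻ θ in Ioo (0 : ℝ) 1,
          ∫⁻ z in ball x r, ‖fderiv ℝ u (x + θ • (z - x))‖ₑ ∂μ := by
        rw [lintegral_const_mul' _ _ ENNReal.ofReal_ne_top, lintegral_lintegral_swap hm.aemeasurable]
    _ ≤ ENNReal.ofReal r * ∫⁻ θ in Ioo (0 : ℝ) 1,
          μ (ball x r) * maximalFunction μ (fun y => ‖fderiv ℝ u y‖ₑ) x := by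
        gcongr 1
        exact setLIntegral_mono' measurableSet_Ioo fun θ hθ =>
          lintegral_ball_comp_homothety_le μ hfd.enorm.measurable x hr hθ.1
    _ = _ := by simp

/-- The pointwise Lipschitz estimate of a `C¹` map by the maximal function of its derivative. -/
theorem ContDiff.enorm_sub_le_maximalFunction (μ : Measure E) [μ.IsAddHaarMeasure] {u : E → F}
    (hu : ContDiff ℝ 1 u) (x y : E) :
    ‖u x - u y‖ₑ ≤ 2 * 2 ^ Module.finrank ℝ E * ‖x - y‖ₑ *
      (maximalFunction μ (fun z => ‖fderiv ℝ u z‖ₑ) x +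
        maximalFunction μ (fun z => ‖fderiv ℝ u z‖ₑ) y) := by
  rcases eq_or_ne x y with rfl | hxy
  · simp
  set r := ‖x - y‖ with hrdef
  have hr : 0 < r := norm_pos_iff.2 (sub_ne_zero.2 hxy)
  set M := maximalFunction μ (fun z => ‖fderiv ℝ u z‖ₑ)
  set D := (2 : ℝ≥0∞) ^ Module.finrank ℝ E with hD
  have hD1 : 1 ≤ D := one_le_pow₀ one_le_two
  have hB0 : μ (ball x r) ≠ 0 := (measure_ball_pos μ x hr).ne'
  have hrx : ‖x - y‖ₑ = ENNReal.ofReal r := (ofReal_norm _).symm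
  -- The triangle inequality through `z` is averaged over `ball x r`. Around `y` this ball is
  -- enclosed in one of twice the radius, at the cost of the doubling factor `D`.
  have hsub : ball x r ⊆ ball y (2 * r) := by
    refine ball_subset_ball' ?_
    rw [dist_eq_norm]; linarith
  have hB2 : μ (ball y (2 * r)) = D * μ (ball x r) := by
    rw [Measure.addHaar_ball_mul_of_pos μ y two_pos, Measure.addHaar_ball_center μ x r, hD,
      ENNReal.ofReal_pow zero_le_two, ENNReal.ofReal_ofNat]
  have hcu := hu.continuous
  have key : μ (ball x r) * ‖u x - u y‖ₑ ≤
      μ (ball x r) * (2 * D * ‖x - y‖ₑ * (M x + M y)) := by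
    calc μ (ball x r) * ‖u x - u y‖ₑ = ∫⁻ z in ball x r, ‖u x - u y‖ₑ ∂μ := by
          simp [mul_comm]
      _ ≤ ∫⁻ z in ball x r, (‖u z - u x‖ₑ + ‖u z - u y‖ₑ) ∂μ := by
          refine lintegral_mono fun z => ?_
          calc ‖u x - u y‖ₑ = ‖(u x - u z) + (u z - u y)‖ₑ := by congr 1; abel
            _ ≤ ‖u x - u z‖ₑ + ‖u z - u y‖ₑ := enorm_add_le _ _
            _ = _ := by rw [enorm_sub_rev]
      _ = ∫⁻ z in ball x r, ‖u z - u x‖ₑ ∂μ + ∫⁻ z in ball x r, ‖u z - u y‖ₑ ∂μ :=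
          lintegral_add_left (Continuous.measurable (by fun_prop)) _
      _ ≤ ENNReal.ofReal r * (μ (ball x r) * M x) +
            ENNReal.ofReal (2 * r) * (μ (ball y (2 * r)) * M y) := by
          gcongr
          · exact lintegral_ball_enorm_sub_le μ hu x hr
          · exact (lintegral_mono_set hsub).trans (lintegral_ball_enorm_sub_le μ hu y (by positivity))
      _ = μ (ball x r) * (1 * ‖x - y‖ₑ * M x + 2 * D * ‖x - y‖ₑ * M y) := by
          rw [hB2, hrx, ENNReal.ofReal_mul zero_le_two, ENNReal.ofReal_ofNat]
          ring
      _ ≤ μ (ball x r) * (2 * D * ‖x - y‖ₑ * M x + 2 * D * ‖x - y‖ₑ * M y) := by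
          gcongr
          calc (1 : ℝ≥0∞) ≤ D := hD1
            _ ≤ 2 * D := le_mul_of_one_le_left' one_le_two
      _ = _ := by ring
  exact (ENNReal.mul_le_mul_iff_right hB0 measure_ball_lt_top.ne).1 key

/-- The maximal function of a convolution with a nonnegative kernel is at most the convolution
of the maximal function. -/
theorem maximalFunction_le_lintegral_mul (μ : Measure E) [μ.IsAddHaarMeasure]
    {g h w : E → ℝ≥0∞} (hg : AEMeasurable g μ) (hw : Measurable w)
    (hh : ∀ x, h x ≤ ∫⁻ t, w t * g (x - t) ∂μ) (x : E) :
    maximalFunction μ h x ≤ ∫⁻ t, w t * maximalFunction μ g (x - t) ∂μ := by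
  obtain ⟨g', hg', hgg⟩ := hg
  have hh' : ∀ x, h x ≤ ∫⁻ t, w t * g' (x - t) ∂μ := fun x => by
    refine (hh x).trans_eq (lintegral_congr_ae ?_)
    filter_upwards [(quasiMeasurePreserving_sub_left μ x).ae hgg] with t ht
    rw [ht]
  rw [maximalFunction_congr_ae hgg]
  refine iSup_le fun c => iSup_le fun r => iSup_le fun hx => ENNReal.div_le_of_le_mul ?_
  calc ∫⁻ z in ball c r, h z ∂μ ≤ ∫⁻ z in ball c r, ∫⁻ t, w t * g' (z - t) ∂μ ∂μ :=
        lintegral_mono fun z => hh' z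
    _ = ∫⁻ t, w t * ∫⁻ z in ball c r, g' (z - t) ∂μ ∂μ := by
        rw [lintegral_lintegral_swap (by fun_prop)]
        exact lintegral_congr fun t => lintegral_const_mul _ (by fun_prop)
    _ ≤ ∫⁻ t, w t * (μ (ball c r) * maximalFunction μ g' (x - t)) ∂μ := by
        gcongr with t
        -- Translating by `t` moves the ball to one of equal volume that contains `x - t`.
        have h1 : ∫⁻ z in ball c r, g' (z - t) ∂μ = ∫⁻ y in ball (c - t) r, g' y ∂μ := by
          rw [← lintegral_indicator measurableSet_ball, ← lintegral_indicator measurableSet_ball,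
            ← lintegral_sub_right_eq_self ((ball (c - t) r).indicator g') t]
          refine lintegral_congr fun z => ?_
          have : z - t ∈ ball (c - t) r ↔ z ∈ ball c r := by simp [dist_eq_norm]
          by_cases hz : z ∈ ball c r <;> simp only [indicator, this, hz, if_true, if_false]
        rw [h1, ← Measure.addHaar_ball_center μ (c - t) r |>.trans
          (Measure.addHaar_ball_center μ c r).symm]
        exact lintegral_ball_le_measure_mul_maximalFunction μ g' (by simpa [dist_eq_norm] using hx)
    _ = (∫⁻ t, w t * maximalFunction μ g' (x - t) ∂μ) * μ (ball c r) := by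
        rw [mul_comm, ← lintegral_const_mul' _ _ measure_ball_lt_top.ne]
        exact lintegral_congr fun t => by ring

end RadialAverages

/-! ### Passage to Sobolev maps by mollification -/

section WeakDerivatives

open ContinuousLinearMap Filter
open scoped Convolution Topology

variable {d : ℕ} {f : Rd d → Rd d} {A : Rd d → Rd d →L[ℝ] Rd d}

theorem HasWeakFDeriv.fderiv_convolution_apply (h : HasWeakFDeriv f A) {ρ : Rd d → ℝ}
    (hρ : ContDiff ℝ ∞ ρ) (hc : HasCompactSupport ρ) (x v : Rd d) :
    fderiv ℝ (ρ ⋆[lsmul ℝ ℝ, volume] f) x v = ∫ t, ρ t • A (x - t) v := by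
  have hρ1 : ContDiff ℝ 1 ρ := hρ.of_le (by simp)
  rw [(hc.hasFDerivAt_convolution_left (lsmul ℝ ℝ) hρ1 h.locallyIntegrable x).fderiv, convolution]
  have hex := (hc.fderiv ℝ).convolutionExists_left ((lsmul ℝ ℝ).precompL (Rd d))
    (hρ1.continuous_fderiv one_ne_zero) h.locallyIntegrable x
  rw [ContinuousLinearMap.integral_apply hex]
  simp only [precompL_apply, lsmul_apply]
  -- The derivative of the convolution falls on `ρ`. The reflected translate `ψ` is the test
  -- function that moves it onto `f`; the sign from the reflection cancels that of the weak
  -- derivative.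
  set ψ : Rd d → ℝ := fun y => ρ (x - y) with hψ
  have hψs : ContDiff ℝ ∞ ψ := hρ.comp (contDiff_const.sub contDiff_id)
  have hψc : HasCompactSupport ψ := hc.comp_homeomorph (Homeomorph.subLeft x)
  have hψd : ∀ y, fderiv ℝ ψ y v = -fderiv ℝ ρ (x - y) v := by
    intro y
    have h1 := (hρ1.differentiable one_ne_zero (x - y)).hasFDerivAt.comp y
      ((hasFDerivAt_id y).const_sub x)
    have h2 : HasFDerivAt ψ _ y := h1
    rw [h2.fderiv]
    simp
  have hw := h.integral_eq ψ hψs hψc v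
  rw [← integral_sub_left_eq_self (fun t => fderiv ℝ ρ t v • f (x - t)) volume x,
    ← integral_sub_left_eq_self (fun t => ρ t • A (x - t) v) volume x]
  simp only [sub_sub_cancel]
  simp only [hψd, neg_smul, integral_neg, neg_neg] at hw
  exact hw.symm

theorem enorm_le_of_forall_enorm_apply_le {E F : Type*} [NormedAddCommGroup E] [NormedSpace ℝ E]
    [NormedAddCommGroup F] [NormedSpace ℝ F] (L : E →L[ℝ] F) {a : ℝ≥0∞}
    (h : ∀ v, ‖L v‖ₑ ≤ a * ‖v‖ₑ) : ‖L‖ₑ ≤ a := by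
  induction a with
  | top => exact le_top
  | coe a =>
    have : ‖L‖₊ ≤ a := L.opNNNorm_le_bound a fun v => by
      have := h v
      simp only [enorm_eq_nnnorm] at this
      exact_mod_cast this
    exact_mod_cast this

theorem HasWeakFDeriv.enorm_fderiv_convolution_le (h : HasWeakFDeriv f A) {ρ : Rd d → ℝ}
    (hρ : ContDiff ℝ ∞ ρ) (hc : HasCompactSupport ρ) (x : Rd d) :
    ‖fderiv ℝ (ρ ⋆[lsmul ℝ ℝ, volume] f) x‖ₑ ≤ ∫⁻ t, ‖ρ t‖ₑ * ‖A (x - t)‖ₑ := by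
  refine enorm_le_of_forall_enorm_apply_le _ fun v => ?_
  rw [h.fderiv_convolution_apply hρ hc x v]
  refine (enorm_integral_le_lintegral_enorm _).trans ?_
  rw [← lintegral_mul_const' _ _ enorm_ne_top]
  refine lintegral_mono fun t => ?_
  rw [enorm_smul, mul_assoc]
  gcongr
  exact (A (x - t)).le_opENorm v

/-- A sequence of bump functions concentrating at the origin. -/
noncomputable def bumpSeq (d n : ℕ) : ContDiffBump (0 : Rd d) where
  rIn := 1 / ((n : ℝ) + 1)
  rOut := 2 * (1 / ((n : ℝ) + 1))
  rIn_pos := by positivity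
  rIn_lt_rOut := by
    have : (0 : ℝ) < 1 / ((n : ℝ) + 1) := by positivity
    linarith

theorem ae_tendsto_bumpSeq_convolution {G : Type*} [NormedAddCommGroup G] [NormedSpace ℝ G]
    [CompleteSpace G] {g : Rd d → G} (hg : LocallyIntegrable g) :
    ∀ᵐ x, Tendsto (fun n => ((bumpSeq d n).normed volume ⋆[lsmul ℝ ℝ, volume] g) x) atTop
      (𝓝 (g x)) := by
  -- The ratio of outer to inner radius stays equal to 2, as Lebesgue differentiation requires.
  refine ContDiffBump.ae_convolution_tendsto_right_of_locallyIntegrable (K := 2) ?_ ?_ hg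
  · simpa [bumpSeq] using tendsto_one_div_add_atTop_nhds_zero_nat.const_mul (2 : ℝ)
  · exact Eventually.of_forall fun n => le_rfl

/-- The pointwise Lipschitz estimate of a Sobolev map by the maximal function of its weak
derivative. -/
theorem HasWeakFDeriv.exists_null_enorm_sub_le (h : HasWeakFDeriv f A)
    (hfin : ∀ᵐ x, maximalFunction volume (fun y => ‖A y‖ₑ) x < ⊤)
    (hloc : LocallyIntegrable fun x => (maximalFunction volume (fun y => ‖A y‖ₑ) x).toReal) :
    ∃ s : Set (Rd d), s ∈ ae volume ∧ ∀ x ∈ s, ∀ y ∈ s,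
      ‖f x - f y‖ₑ ≤ 2 * 2 ^ d * ‖x - y‖ₑ *
        (maximalFunction volume (fun y => ‖A y‖ₑ) x +
          maximalFunction volume (fun y => ‖A y‖ₑ) y) := by
  set M := maximalFunction volume (fun y => ‖A y‖ₑ) with hM
  set G : Rd d → ℝ := fun x => (M x).toReal with hG
  set ρ : ℕ → Rd d → ℝ := fun n => (bumpSeq d n).normed volume with hρdef
  have hρs : ∀ n, ContDiff ℝ ∞ (ρ n) := fun n => (bumpSeq d n).contDiff_normed
  have hρc : ∀ n, HasCompactSupport (ρ n) := fun n => (bumpSeq d n).hasCompactSupport_normed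
  have hρ0 : ∀ n x, 0 ≤ ρ n x := fun n x => (bumpSeq d n).nonneg_normed x
  set u : ℕ → Rd d → Rd d := fun n => ρ n ⋆[lsmul ℝ ℝ, volume] f with hu
  have hus : ∀ n, ContDiff ℝ 1 (u n) := fun n =>
    (hρc n).contDiff_convolution_left _ ((hρs n).of_le (by simp)) h.locallyIntegrable
  -- The maximal function of the mollified derivative is at most the mollification of `M`, which
  -- converges to `M` almost everywhere. The constants thus survive the limit, and the exceptional
  -- set does not depend on the pair of points.
  have hMu : ∀ n x, maximalFunction volume (fun z => ‖fderiv ℝ (u n) z‖ₑ) x ≤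
      ENNReal.ofReal ((ρ n ⋆[lsmul ℝ ℝ, volume] G) x) := by
    intro n x
    refine (maximalFunction_le_lintegral_mul volume
      h.locallyIntegrable_deriv.aestronglyMeasurable.enorm (hρs n).continuous.enorm.measurable
      (fun x => h.enorm_fderiv_convolution_le (hρs n) (hρc n) x) x).trans_eq ?_
    rw [convolution, ofReal_integral_eq_lintegral_ofReal]
    · refine lintegral_congr_ae ?_
      filter_upwards [(quasiMeasurePreserving_sub_left volume x).ae hfin] with t ht
      simp only [lsmul_apply, smul_eq_mul]
      rw [ENNReal.ofReal_mul (hρ0 n t), hG, ENNReal.ofReal_toReal ht.ne,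
        Real.enorm_of_nonneg (hρ0 n t)]
    · exact (hρc n).convolutionExists_left (lsmul ℝ ℝ) (hρs n).continuous hloc x
    · refine Eventually.of_forall fun t => ?_
      simp only [lsmul_apply, smul_eq_mul]
      exact mul_nonneg (hρ0 n t) ENNReal.toReal_nonneg
  have h1 := ae_tendsto_bumpSeq_convolution h.locallyIntegrable
  have h2 := ae_tendsto_bumpSeq_convolution hloc
  refine ⟨_, (h1.and (h2.and hfin)), ?_⟩
  rintro x ⟨hx1, hx2, hx3⟩ y ⟨hy1, hy2, hy3⟩
  have hGM : ∀ z, M z < ⊤ → ENNReal.ofReal (G z) = M z := fun z hz => ENNReal.ofReal_toReal hz.ne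
  have hlim1 : Tendsto (fun n => ‖u n x - u n y‖ₑ) atTop (𝓝 ‖f x - f y‖ₑ) := (hx1.sub hy1).enorm
  have hlim2 : Tendsto (fun n => 2 * 2 ^ d * ‖x - y‖ₑ *
      (ENNReal.ofReal ((ρ n ⋆[lsmul ℝ ℝ, volume] G) x) +
        ENNReal.ofReal ((ρ n ⋆[lsmul ℝ ℝ, volume] G) y))) atTop
      (𝓝 (2 * 2 ^ d * ‖x - y‖ₑ * (M x + M y))) := by
    rw [← hGM x hx3, ← hGM y hy3]
    refine ENNReal.Tendsto.const_mul ((ENNReal.tendsto_ofReal hx2).add (ENNReal.tendsto_ofReal hy2))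
      (.inr ?_)
    exact ENNReal.mul_ne_top (ENNReal.mul_ne_top (by simp) (by simp)) enorm_ne_top
  refine le_of_tendsto_of_tendsto' hlim1 hlim2 fun n => ?_
  refine ((hus n).enorm_sub_le_maximalFunction volume x y).trans ?_
  rw [finrank_euclideanSpace_fin]
  gcongr
  · exact hMu n x
  · exact hMu n y

/-- The estimate of the difference quotients of a map with essentially bounded weak derivative. -/
theorem HasWeakFDeriv.exists_null_enorm_sub_le_of_eLpNorm_top (h : HasWeakFDeriv f A)
    (hA : eLpNorm A ⊤ volume < ⊤) :
    ∃ s : Set (Rd d), s ∈ ae volume ∧ ∀ x ∈ s, ∀ y ∈ s,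
      ‖f x - f y‖ₑ ≤ 4 * 2 ^ d * ‖x - y‖ₑ * eLpNorm A ⊤ volume := by
  set M := maximalFunction volume (fun y => ‖A y‖ₑ) with hM
  have hMle : ∀ x, M x ≤ eLpNorm A ⊤ volume := fun x =>
    maximalFunction_le_of_ae_le volume (by rw [eLpNorm_exponent_top]; exact ae_le_eLpNormEssSup) x
  have hloc : LocallyIntegrable fun x => (M x).toReal := by
    refine MemLp.locallyIntegrable (p := ⊤) ?_ le_top
    refine memLp_top_of_bound (measurable_maximalFunction _ _).ennreal_toReal.aestronglyMeasurable
      (eLpNorm A ⊤ volume).toReal (Eventually.of_forall fun x => ?_)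
    rw [Real.norm_of_nonneg ENNReal.toReal_nonneg]
    exact ENNReal.toReal_mono hA.ne (hMle x)
  obtain ⟨s, hs, hfs⟩ := h.exists_null_enorm_sub_le
    (Eventually.of_forall fun x => (hMle x).trans_lt hA) hloc
  refine ⟨s, hs, fun x hx y hy => (hfs x hx y hy).trans ?_⟩
  calc 2 * 2 ^ d * ‖x - y‖ₑ * (M x + M y)
      ≤ 2 * 2 ^ d * ‖x - y‖ₑ * (eLpNorm A ⊤ volume + eLpNorm A ⊤ volume) := by
        gcongr
        · exact hMle x
        · exact hMle y
    _ = _ := by ring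

/-- The estimate of the difference quotients of a map with weak derivative in `L^p`. -/
theorem exists_forall_hasWeakFDeriv_enorm_sub_le (d : ℕ) {p : ℝ≥0∞} (hp1 : 1 < p) (hp : p < ⊤) :
    ∃ C : ℝ≥0, ∀ (f : Rd d → Rd d) (A : Rd d → Rd d →L[ℝ] Rd d), HasWeakFDeriv f A →
      eLpNorm A p volume < ⊤ →
      ∃ m : Rd d → ℝ≥0∞, Measurable m ∧ eLpNorm m p volume ≤ C * eLpNorm A p volume ∧
        ∃ s : Set (Rd d), s ∈ ae volume ∧ ∀ x ∈ s, ∀ y ∈ s,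
          ‖f x - f y‖ₑ ≤ ‖x - y‖ₑ * (m x + m y) := by
  have hp0 : p ≠ 0 := (zero_lt_one.trans hp1).ne'
  have hq : 1 < p.toReal := by
    rw [← ENNReal.toReal_one]
    exact (ENNReal.toReal_lt_toReal ENNReal.one_ne_top hp.ne).2 hp1
  have hq0 : 0 < p.toReal := by linarith
  obtain ⟨C, hC⟩ := exists_lintegral_maximalFunction_rpow_le (volume : Measure (Rd d)) hq
  refine ⟨2 * 2 ^ d * C ^ (1 / p.toReal), fun f A h hA => ?_⟩
  set M := maximalFunction volume (fun y => ‖A y‖ₑ) with hM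
  have hMm : Measurable M := measurable_maximalFunction _ _
  have hMp : eLpNorm M p volume ≤ (C ^ (1 / p.toReal) : ℝ≥0) * eLpNorm A p volume := by
    rw [eLpNorm_eq_lintegral_rpow_enorm_toReal hp0 hp.ne,
      eLpNorm_eq_lintegral_rpow_enorm_toReal hp0 hp.ne, ENNReal.coe_rpow_of_nonneg _ (by positivity),
      ← ENNReal.mul_rpow_of_nonneg _ _ (by positivity)]
    gcongr
    exact hC _ h.locallyIntegrable_deriv.aestronglyMeasurable.enorm
  have hMtop : eLpNorm M p volume < ⊤ := hMp.trans_lt (ENNReal.mul_lt_top (by simp) hA)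
  have hfin : ∀ᵐ x, M x < ⊤ := by
    have h1 : ∫⁻ x, M x ^ p.toReal < ⊤ := by
      have := lintegral_rpow_enorm_lt_top_of_eLpNorm_lt_top hp0 hp.ne hMtop
      simpa using this
    filter_upwards [ae_lt_top (hMm.pow_const _) h1.ne] with x hx
    by_contra! hx'
    rw [top_le_iff.1 hx', ENNReal.top_rpow_of_pos hq0] at hx
    exact lt_irrefl _ hx
  have hloc : LocallyIntegrable fun x => (M x).toReal := by
    refine MemLp.locallyIntegrable (p := p) ⟨hMm.ennreal_toReal.aestronglyMeasurable, ?_⟩ hp1.le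
    refine lt_of_le_of_lt (eLpNorm_mono_enorm fun x => ?_) hMtop
    rw [Real.enorm_of_nonneg ENNReal.toReal_nonneg]
    exact ENNReal.ofReal_toReal_le
  obtain ⟨s, hs, hfs⟩ := h.exists_null_enorm_sub_le hfin hloc
  refine ⟨fun x => 2 * 2 ^ d * M x, hMm.const_mul _, ?_, s, hs, fun x hx y hy => ?_⟩
  · calc eLpNorm (fun x => 2 * 2 ^ d * M x) p volume
        ≤ (2 * 2 ^ d : ℝ≥0) • eLpNorm M p volume :=
          eLpNorm_le_nnreal_smul_eLpNorm_of_ae_le_mul' (Eventually.of_forall fun x => by simp) p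
      _ ≤ (2 * 2 ^ d : ℝ≥0) • ((C ^ (1 / p.toReal) : ℝ≥0) * eLpNorm A p volume) := by gcongr
      _ = _ := by rw [ENNReal.smul_def, smul_eq_mul, ← mul_assoc, ENNReal.coe_mul (2 * 2 ^ d)]
  · refine (hfs x hx y hy).trans_eq (by ring)

end WeakDerivatives

/-! ### Logarithmic growth of the distance between trajectories -/

section Trajectories

open Filter
open scoped Topology

theorem AbsolutelyContinuousOnInterval.of_dist_le {X Y : Type*} [PseudoMetricSpace X]
    [PseudoMetricSpace Y] {f : ℝ → X} {g : ℝ → Y} {a b K : ℝ}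
    (hf : AbsolutelyContinuousOnInterval f a b)
    (h : ∀ s ∈ uIcc a b, ∀ t ∈ uIcc a b, dist (g s) (g t) ≤ K * dist (f s) (f t)) :
    AbsolutelyContinuousOnInterval g a b := by
  refine squeeze_zero' (Eventually.of_forall fun E => Finset.sum_nonneg fun _ _ => dist_nonneg) ?_
    (by simpa using Tendsto.const_mul K hf)
  filter_upwards [mem_inf_of_right (mem_principal_self _)] with E hE
  rw [Finset.mul_sum]
  exact Finset.sum_le_sum fun i hi => h _ (hE.1 i hi).1 _ (hE.1 i hi).2

/-- Increments of the vector-valued primitive are dominated by those of the scalar primitive of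
`‖H‖`. -/
theorem IntervalIntegrable.absolutelyContinuousOnInterval_integral {F : Type*}
    [NormedAddCommGroup F] [NormedSpace ℝ F] {H : ℝ → F} {a b c : ℝ}
    (hH : IntervalIntegrable H volume a b) (hc : c ∈ uIcc a b) :
    AbsolutelyContinuousOnInterval (fun τ => ∫ z in c..τ, H z) a b := by
  refine (hH.norm.absolutelyContinuousOnInterval_intervalIntegral hc).of_dist_le (K := 1)
    fun s hs t ht => ?_
  have hI : ∀ τ ∈ uIcc a b, IntervalIntegrable H volume c τ := fun τ hτ =>
    hH.mono_set (uIcc_subset_uIcc hc hτ)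
  rw [one_mul, dist_eq_norm, Real.dist_eq,
    intervalIntegral.integral_interval_sub_left (hI s hs) (hI t ht),
    intervalIntegral.integral_interval_sub_left (hI s hs).norm (hI t ht).norm]
  exact intervalIntegral.norm_integral_le_abs_integral_norm

theorem abs_log_div_add_one_sub_le {δ : ℝ} (hδ : 0 < δ) {a b : ℝ} (ha : 0 ≤ a) (hb : 0 ≤ b) :
    |Real.log (a / δ + 1) - Real.log (b / δ + 1)| ≤ δ⁻¹ * |a - b| := by
  wlog hab : b ≤ a generalizing a b
  · rw [abs_sub_comm, abs_sub_comm a]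
    exact this hb ha (le_of_not_ge hab)
  have hb1 : 0 < b / δ + 1 := by positivity
  have ha1 : 0 < a / δ + 1 := by positivity
  have hle : b / δ + 1 ≤ a / δ + 1 := by gcongr
  rw [abs_of_nonneg (sub_nonneg.2 (Real.log_le_log hb1 hle)), abs_of_nonneg (sub_nonneg.2 hab),
    ← Real.log_div ha1.ne' hb1.ne']
  calc Real.log ((a / δ + 1) / (b / δ + 1)) ≤ (a / δ + 1) / (b / δ + 1) - 1 :=
        Real.log_le_sub_one_of_pos (by positivity)
    _ = (a - b) / (b + δ) := by field_simp; ring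
    _ ≤ (a - b) / δ := by
        apply div_le_div_of_nonneg_left (by linarith) hδ (by linarith)
    _ = _ := by ring

/-- Difference quotients of the norm are bounded by norms of difference quotients. The norm itself
need not be differentiable, in particular where the curve meets the origin. -/
theorem HasDerivAt.abs_le_of_norm {F : Type*} [NormedAddCommGroup F] [NormedSpace ℝ F]
    {h : ℝ → F} {h' : F} {m' t : ℝ} (hh : HasDerivAt h h' t)
    (hm : HasDerivAt (fun s => ‖h s‖) m' t) : |m'| ≤ ‖h'‖ := by
  have h1 := (hasDerivAt_iff_tendsto_slope.1 hm).abs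
  have h2 := (hasDerivAt_iff_tendsto_slope.1 hh).norm
  refine le_of_tendsto_of_tendsto' h1 h2 fun s => ?_
  rw [slope_def_field, slope_def_module, norm_smul, abs_div, norm_inv, Real.norm_eq_abs,
    div_eq_inv_mul]
  gcongr
  exact abs_norm_sub_norm_le _ _

/-- The growth of the logarithm along an absolutely continuous curve starting from the origin. -/
theorem ofReal_log_norm_integral_le {F : Type*} [NormedAddCommGroup F] [NormedSpace ℝ F]
    [CompleteSpace F] {T δ : ℝ} (hδ : 0 < δ) {H : ℝ → F} (hT : 0 ≤ T)
    (hH : IntervalIntegrable H volume 0 T) {s t : ℝ} (hs : s ∈ Icc 0 T) (ht : t ∈ Icc 0 T) :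
    ENNReal.ofReal (Real.log (‖∫ z in s..t, H z‖ / δ + 1)) ≤
      ∫⁻ τ in Icc 0 T, ‖H τ‖ₑ / (‖∫ z in s..τ, H z‖ₑ + ENNReal.ofReal δ) := by
  obtain ⟨h, hh⟩ : ∃ h : ℝ → F, h = fun τ => ∫ z in s..τ, H z := ⟨_, rfl⟩
  obtain ⟨m, hm⟩ : ∃ m : ℝ → ℝ, m = fun τ => ‖h τ‖ := ⟨_, rfl⟩
  obtain ⟨φ, hφ⟩ : ∃ φ : ℝ → ℝ, φ = fun τ => Real.log (m τ / δ + 1) := ⟨_, rfl⟩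
  have hm0 : ∀ τ, 0 ≤ m τ := fun τ => by rw [hm]; exact norm_nonneg _
  have hmh : ∀ τ, ENNReal.ofReal (m τ) = ‖h τ‖ₑ := fun τ => by rw [hm]; exact ofReal_norm _
  suffices ENNReal.ofReal (φ t) ≤ ∫⁻ τ in Icc 0 T, ‖H τ‖ₑ / (‖h τ‖ₑ + ENNReal.ofReal δ) by
    simpa only [hφ, hm, hh] using this
  have hsT : s ∈ uIcc 0 T := by rwa [uIcc_of_le hT]
  have hst : uIcc s t ⊆ uIcc 0 T := by
    rw [uIcc_of_le hT]; exact uIcc_subset_Icc hs ht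
  have hAC : AbsolutelyContinuousOnInterval h 0 T := by
    rw [hh]
    exact hH.absolutelyContinuousOnInterval_integral hsT
  have hmAC : AbsolutelyContinuousOnInterval m 0 T := hAC.of_dist_le (K := 1) fun a _ b _ => by
    rw [one_mul, Real.dist_eq, dist_eq_norm, hm]; exact abs_norm_sub_norm_le _ _
  have hφAC : AbsolutelyContinuousOnInterval φ 0 T := hmAC.of_dist_le (K := δ⁻¹) fun a _ b _ => by
    rw [hφ]; exact abs_log_div_add_one_sub_le hδ (hm0 a) (hm0 b)
  have hφs : φ s = 0 := by simp [hφ, hm, hh]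
  -- At almost every time both the curve and its norm are differentiable, and `φ' = m' / (m + δ)`
  -- with `|m'| ≤ ‖H‖`.
  have hbound : ∀ᵐ τ, τ ∈ uIcc 0 T → ‖deriv φ τ‖ₑ ≤ ‖H τ‖ₑ / (‖h τ‖ₑ + ENNReal.ofReal δ) := by
    filter_upwards [hmAC.ae_differentiableAt, hH.ae_hasDerivAt_integral] with τ h1 h2 hτ
    have hm1 := (h1 hτ).hasDerivAt
    have h3 := h2 hτ s hsT
    rw [← hh] at h3
    have hle := h3.abs_le_of_norm (by rw [← hm]; exact hm1)
    have hm0τ := hm0 τ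
    have hmpos : 0 < m τ / δ + 1 := by positivity
    have hφ' : HasDerivAt φ (deriv m τ / δ / (m τ / δ + 1)) τ := by
      rw [hφ]
      exact ((hm1.div_const δ).add_const 1).log hmpos.ne'
    have heq : deriv m τ / δ / (m τ / δ + 1) = deriv m τ / (m τ + δ) := by field_simp
    have hpos : 0 < m τ + δ := by positivity
    rw [hφ'.deriv, heq, Real.enorm_eq_ofReal_abs, abs_div, abs_of_pos hpos,
      ENNReal.ofReal_div_of_pos hpos, ENNReal.ofReal_add hm0τ hδ.le, hmh,
      ← ofReal_norm (H τ)]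
    gcongr
  have hFTC := (hφAC.mono hst).integral_deriv_eq_sub
  rw [hφs, sub_zero] at hFTC
  have hφt : 0 ≤ φ t := by
    rw [hφ]
    exact Real.log_nonneg (by linarith [div_nonneg (hm0 t) hδ.le])
  calc ENNReal.ofReal (φ t) = ‖φ t‖ₑ := (Real.enorm_of_nonneg hφt).symm
    _ = ‖∫ τ in uIoc s t, deriv φ τ‖ₑ := by
        rw [← hFTC, ← ofReal_norm, intervalIntegral.norm_intervalIntegral_eq, ofReal_norm]
    _ ≤ ∫⁻ τ in uIoc s t, ‖deriv φ τ‖ₑ := enorm_integral_le_lintegral_enorm _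
    _ ≤ ∫⁻ τ in Icc 0 T, ‖deriv φ τ‖ₑ := by
        refine lintegral_mono_set (uIoc_subset_uIcc.trans (hst.trans_eq (uIcc_of_le hT)))
    _ ≤ _ := by
        refine lintegral_mono_ae ?_
        rw [ae_restrict_iff' measurableSet_Icc, ← uIcc_of_le hT]
        exact hbound

theorem ofReal_log_norm_sub_le {F : Type*} [NormedAddCommGroup F] [NormedSpace ℝ F]
    [CompleteSpace F] {T δ : ℝ} (hδ : 0 < δ) (hT : 0 ≤ T) {u1 u2 x1 x2 : ℝ → F} {x : F} {s t : ℝ}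
    (hs : s ∈ Icc 0 T) (ht : t ∈ Icc 0 T)
    (hu1 : IntegrableOn u1 (Ioo 0 T)) (hu2 : IntegrableOn u2 (Ioo 0 T))
    (hx1 : ∀ t ∈ Icc 0 T, x1 t = x + ∫ z in s..t, u1 z)
    (hx2 : ∀ t ∈ Icc 0 T, x2 t = x + ∫ z in s..t, u2 z) :
    ENNReal.ofReal (Real.log (‖x1 t - x2 t‖ / δ + 1)) ≤
      ∫⁻ τ in Icc 0 T, ‖u1 τ - u2 τ‖ₑ / (‖x1 τ - x2 τ‖ₑ + ENNReal.ofReal δ) := by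
  have hI : ∀ u : ℝ → F, IntegrableOn u (Ioo 0 T) → IntervalIntegrable u volume 0 T := fun u hu => by
    rw [intervalIntegrable_iff_integrableOn_Ioo_of_le hT]; exact hu
  have hsub : ∀ τ ∈ Icc 0 T, x1 τ - x2 τ = ∫ z in s..τ, (u1 z - u2 z) := by
    intro τ hτ
    have hmono : uIcc s τ ⊆ uIcc 0 T := by
      rw [uIcc_of_le hT]; exact uIcc_subset_Icc hs hτ
    rw [hx1 τ hτ, hx2 τ hτ, intervalIntegral.integral_sub ((hI _ hu1).mono_set hmono)
      ((hI _ hu2).mono_set hmono)]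
    abel
  rw [hsub t ht]
  refine (ofReal_log_norm_integral_le hδ hT ((hI _ hu1).sub (hI _ hu2)) hs ht).trans_eq ?_
  exact setLIntegral_congr_fun measurableSet_Icc fun τ hτ => by simp only [hsub τ hτ]

end Trajectories

/-! ### Measurability of slice norms -/

section Slices

open Filter

theorem MeasureTheory.MeasurePreserving.lintegral_comp_of_aemeasurable {α β : Type*}
    [MeasurableSpace α] [MeasurableSpace β] {μ : Measure α} {ν : Measure β} {g : α → β}
    (hg : MeasurePreserving g μ ν) {f : β → ℝ≥0∞} (hf : AEMeasurable f ν) :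
    ∫⁻ a, f (g a) ∂μ = ∫⁻ b, f b ∂ν := by
  rw [← hg.map_eq, lintegral_map' (hg.map_eq.symm ▸ hf) hg.aemeasurable]

/-- The `L^q` norm of the slices of a measurable function is measurable. -/
theorem aemeasurable_eLpNorm_slice {α β F : Type*} [MeasurableSpace α] [MeasurableSpace β]
    [NormedAddCommGroup F] {ν : Measure α} {μ : Measure β} [SFinite μ] {f : α → β → F}
    (hf : AEStronglyMeasurable (Function.uncurry f) (ν.prod μ)) (q : ℝ≥0∞) :
    AEMeasurable (fun t => eLpNorm (f t) q μ) ν := by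
  obtain ⟨g, hg, hfg⟩ := hf
  have hslice : ∀ᵐ t ∂ν, f t =ᵐ[μ] fun x => g (t, x) := Measure.ae_ae_of_ae_prod hfg
  have hm : Measurable fun t => eLpNorm (fun x => g (t, x)) q μ := by
    rcases eq_or_ne q 0 with rfl | hq0
    · simp
    rcases eq_or_ne q ⊤ with rfl | hq
    · refine measurable_of_Ioi fun a => ?_
      have hs : MeasurableSet {z : α × β | a < ‖g z‖ₑ} :=
        measurableSet_lt measurable_const hg.enorm
      -- The essential supremum of a slice exceeds `a` exactly when the slice of the superlevel set
      -- has positive measure.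
      have : (fun t => eLpNorm (fun x => g (t, x)) ⊤ μ) ⁻¹' Ioi a =
          {t | 0 < μ (Prod.mk t ⁻¹' {z | a < ‖g z‖ₑ})} := by
        ext t
        simp only [mem_preimage, mem_Ioi, mem_ofPred_eq, pos_iff_ne_zero, preimage_ofPred_eq]
        rw [← not_le, not_iff_comm, not_ne_iff, eLpNorm_exponent_top]
        constructor
        · intro h
          exact essSup_le_of_ae_le a (by rw [EventuallyLE, ae_iff]; simpa using h)
        · intro h
          have := (ENNReal.ae_le_essSup fun x => ‖g (t, x)‖ₑ).mono fun x hx => hx.trans h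
          rw [ae_iff] at this
          simpa using this
      rw [this]
      exact measurableSet_lt measurable_const (measurable_measure_prodMk_left hs)
    · simp_rw [eLpNorm_eq_lintegral_rpow_enorm_toReal hq0 hq]
      exact (Measurable.lintegral_prod_right' (f := fun z => ‖g z‖ₑ ^ q.toReal)
        (hg.enorm.pow_const _)).pow_const _
  refine ⟨_, hm, ?_⟩
  filter_upwards [hslice] with t ht
  exact eLpNorm_congr_ae ht

/-- Joint almost everywhere bound of a function by the essential supremum of its slices. -/
theorem ae_enorm_le_eLpNorm_top_slice {α β F : Type*} [MeasurableSpace α] [MeasurableSpace β]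
    [NormedAddCommGroup F] {ν : Measure α} {μ : Measure β} [SFinite ν] [SFinite μ] {f : α → β → F}
    (hf : AEStronglyMeasurable (Function.uncurry f) (ν.prod μ)) :
    ∀ᵐ z ∂(ν.prod μ), ‖f z.1 z.2‖ₑ ≤ eLpNorm (f z.1) ⊤ μ := by
  obtain ⟨N, hN, hNf⟩ := aemeasurable_eLpNorm_slice hf ⊤
  obtain ⟨g, hg, hfg⟩ := id hf
  have hslice : ∀ᵐ t ∂ν, f t =ᵐ[μ] fun x => g (t, x) := Measure.ae_ae_of_ae_prod hfg
  -- Passing from a bound on almost every slice to a bound almost everywhere on the product needs a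
  -- measurable set, hence the representatives `g` and `N`.
  have hset : MeasurableSet {z : α × β | ‖g z‖ₑ ≤ N z.1} :=
    measurableSet_le hg.enorm (hN.comp measurable_fst)
  have h1 : ∀ᵐ z ∂(ν.prod μ), ‖g z‖ₑ ≤ N z.1 := by
    rw [Measure.ae_prod_iff_ae_ae hset]
    filter_upwards [hslice, hNf] with t ht htN
    have h2 : ∀ᵐ x ∂μ, ‖f t x‖ₑ ≤ eLpNorm (f t) ⊤ μ := by
      rw [eLpNorm_exponent_top]; exact ae_le_eLpNormEssSup
    filter_upwards [ht, h2] with x hx hx2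
    rw [← hx, ← htN]
    exact hx2
  filter_upwards [h1, hfg, Measure.quasiMeasurePreserving_fst.ae hNf] with z hz1 hz2 hz3
  have : f z.1 z.2 = g z := hz2
  rw [this, hz3]
  exact hz1

end Slices

/-! ### Integration along a regular Lagrangian flow -/

section Flows

variable {d : ℕ} {T : ℝ}

/-- The space-time version of measure preservation pulls back null sets of `[0,T] × ℝ^d`, so
identities and bounds that hold almost everywhere can be evaluated along trajectories. -/
theorem IsRegularLagrangianFlow.measurePreserving_prod {u : ℝ → Rd d → Rd d}
    {X : ℝ → ℝ → Rd d → Rd d} (h : IsRegularLagrangianFlow T u X) {s : ℝ} (hs : s ∈ Icc 0 T) :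
    MeasurePreserving (fun z : ℝ × Rd d => (z.1, X z.1 s z.2))
      ((volume.restrict (Icc (0 : ℝ) T)).prod volume)
      ((volume.restrict (Icc (0 : ℝ) T)).prod volume) := by
  refine (MeasurePreserving.id _).skew_product (g := fun t x => X t s x) ?_ ?_
  · exact h.measurable.comp (f := fun z : ℝ × Rd d => (z.1, s, z.2)) (by fun_prop)
  · rw [ae_restrict_iff' measurableSet_Icc]
    exact Filter.Eventually.of_forall fun t ht => (h.measurePreserving s hs t ht).map_eq

theorem IsRegularLagrangianFlow.aemeasurable_lintegral_enorm {u v : ℝ → Rd d → Rd d}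
    {X : ℝ → ℝ → Rd d → Rd d} (h : IsRegularLagrangianFlow T u X)
    (hv : AEStronglyMeasurable (Function.uncurry v)
      ((volume.restrict (Icc (0 : ℝ) T)).prod volume)) {s : ℝ} (hs : s ∈ Icc 0 T) :
    AEMeasurable (fun z : Rd d × ℝ => ‖v z.2 (X z.2 s z.1)‖ₑ)
      ((volume : Measure (Rd d)).prod (volume.restrict (Icc (0 : ℝ) T))) := by
  have hm : AEMeasurable (fun z : ℝ × Rd d => ‖v z.1 (X z.1 s z.2)‖ₑ)
      ((volume.restrict (Icc (0 : ℝ) T)).prod volume) :=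
    (hv.comp_measurePreserving (h.measurePreserving_prod hs)).enorm
  exact hm.prod_swap

theorem IsRegularLagrangianFlow.lintegral_lintegral_enorm {u v : ℝ → Rd d → Rd d}
    {X : ℝ → ℝ → Rd d → Rd d} (h : IsRegularLagrangianFlow T u X)
    (hv : AEStronglyMeasurable (Function.uncurry v)
      ((volume.restrict (Icc (0 : ℝ) T)).prod volume)) {s : ℝ} (hs : s ∈ Icc 0 T) :
    ∫⁻ x, ∫⁻ z in Icc 0 T, ‖v z (X z s x)‖ₑ = L1LqNorm T 1 volume v := by
  have hF := h.measurePreserving_prod hs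
  have hm : AEMeasurable (fun z : ℝ × Rd d => ‖v z.1 (X z.1 s z.2)‖ₑ)
      ((volume.restrict (Icc (0 : ℝ) T)).prod volume) := (hv.comp_measurePreserving hF).enorm
  rw [lintegral_lintegral_swap (h.aemeasurable_lintegral_enorm hv hs), L1LqNorm]
  simp_rw [eLpNorm_one_eq_lintegral_enorm]
  rw [lintegral_lintegral hm, lintegral_lintegral hv.enorm]
  exact hF.lintegral_comp_of_aemeasurable hv.enorm

/-- The displacement along a trajectory is at most the sum of the contributions of the two parts of
the field. -/
theorem IsRegularLagrangianFlow.ae_enorm_le {u u1 u2 : ℝ → Rd d → Rd d}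
    {X : ℝ → ℝ → Rd d → Rd d} (h : IsRegularLagrangianFlow T u X)
    (hu : ∀ᵐ z ∂((volume.restrict (Icc (0 : ℝ) T)).prod (volume : Measure (Rd d))),
      u z.1 z.2 = u1 z.1 z.2 + u2 z.1 z.2)
    (hu2 : MemL1Lq T ⊤ u2) {s t : ℝ} (hs : s ∈ Icc 0 T) (ht : t ∈ Icc 0 T) :
    ∀ᵐ x, ‖X t s x‖ₑ ≤
      ‖x‖ₑ + ((∫⁻ z in Icc 0 T, ‖u1 z (X z s x)‖ₑ) + L1LqNorm T ⊤ volume u2) := by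
  have hF := h.measurePreserving_prod hs
  have hae : ∀ᵐ z ∂((volume.restrict (Icc (0 : ℝ) T)).prod (volume : Measure (Rd d))),
      ‖u z.1 (X z.1 s z.2)‖ₑ ≤ ‖u1 z.1 (X z.1 s z.2)‖ₑ + eLpNorm (u2 z.1) ⊤ volume := by
    filter_upwards [hF.quasiMeasurePreserving.ae hu,
      hF.quasiMeasurePreserving.ae (ae_enorm_le_eLpNorm_top_slice hu2.1)] with z hz1 hz2
    rw [hz1]
    exact (enorm_add_le _ _).trans (by gcongr)
  have hae' : ∀ᵐ x, ∀ᵐ z ∂(volume.restrict (Icc (0 : ℝ) T)), ‖u z (X z s x)‖ₑ ≤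
      ‖u1 z (X z s x)‖ₑ + eLpNorm (u2 z) ⊤ volume :=
    Measure.ae_ae_of_ae_prod (Measure.measurePreserving_swap.quasiMeasurePreserving.ae hae)
  filter_upwards [hae', h.integral_eq s hs] with x hx1 hx2
  rw [hx2 t ht]
  refine (enorm_add_le _ _).trans ?_
  gcongr
  calc ‖∫ z in s..t, u z (X z s x)‖ₑ = ‖∫ z in uIoc s t, u z (X z s x)‖ₑ := by
        rw [← ofReal_norm, intervalIntegral.norm_intervalIntegral_eq, ofReal_norm]
    _ ≤ ∫⁻ z in uIoc s t, ‖u z (X z s x)‖ₑ := enorm_integral_le_lintegral_enorm _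
    _ ≤ ∫⁻ z in Icc 0 T, ‖u z (X z s x)‖ₑ :=
        lintegral_mono_set (uIoc_subset_uIcc.trans (uIcc_subset_Icc hs ht))
    _ ≤ ∫⁻ z in Icc 0 T, (‖u1 z (X z s x)‖ₑ + eLpNorm (u2 z) ⊤ volume) :=
        lintegral_mono_ae hx1
    _ = _ := lintegral_add_right' _ (aemeasurable_eLpNorm_slice hu2.1 ⊤)

/-- A trajectory of the flow of an `L¹(L¹) + L¹(L^∞)` field leaves a large ball only on a small set
of initial points. -/
theorem IsRegularLagrangianFlow.measure_ball_inter_le {u u1 u2 : ℝ → Rd d → Rd d}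
    {X : ℝ → ℝ → Rd d → Rd d} (h : IsRegularLagrangianFlow T u X)
    (hu : ∀ᵐ z ∂((volume.restrict (Icc (0 : ℝ) T)).prod (volume : Measure (Rd d))),
      u z.1 z.2 = u1 z.1 z.2 + u2 z.1 z.2)
    (hu1 : MemL1Lq T 1 u1) (hu2 : MemL1Lq T ⊤ u2) {s t : ℝ} (hs : s ∈ Icc 0 T) (ht : t ∈ Icc 0 T)
    {R lam : ℝ} (hR : 0 < R) (hlam : R + (L1LqNorm T ⊤ volume u2).toReal < lam) :
    volume {x | x ∈ ball (0 : Rd d) R ∧ X t s x ∉ ball 0 lam} ≤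
      L1LqNorm T 1 volume u1 / ENNReal.ofReal (lam - R - (L1LqNorm T ⊤ volume u2).toReal) := by
  have hx := h.ae_enorm_le hu hu2 hs ht
  have hNtop : L1LqNorm T ⊤ volume u2 ≠ ⊤ := hu2.2.ne
  generalize L1LqNorm T ⊤ volume u2 = N at hx hNtop hlam ⊢
  rw [← h.lintegral_lintegral_enorm hu1.1 hs]
  have hΦm := (h.aemeasurable_lintegral_enorm hu1.1 hs).lintegral_prod_right'
  obtain ⟨Φ, hΦ⟩ : ∃ Φ : Rd d → ℝ≥0∞, Φ = fun x => ∫⁻ z in Icc 0 T, ‖u1 z (X z s x)‖ₑ := ⟨_, rfl⟩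
  have hΦx : ∀ x, ∫⁻ z in Icc 0 T, ‖u1 z (X z s x)‖ₑ = Φ x := fun x => by rw [hΦ]
  rw [← hΦ] at hΦm
  simp only [hΦx] at hx ⊢
  -- A point going from `B_R` to outside `B_lam` travels at least `lam - R`; the bounded part
  -- accounts for at most `N`, so `Φ` must supply the rest. Chebyshev's inequality for `Φ`
  -- concludes.
  have hsub : {x | x ∈ ball (0 : Rd d) R ∧ X t s x ∉ ball 0 lam} ≤ᵐ[volume]
      {x | ENNReal.ofReal (lam - R - N.toReal) ≤ Φ x} := by
    filter_upwards [hx] with x hx2 hx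
    obtain ⟨hxR, hxl⟩ : x ∈ ball (0 : Rd d) R ∧ X t s x ∉ ball 0 lam := hx
    have hxR' : ‖x‖ₑ ≤ ENNReal.ofReal R := by
      rw [← ofReal_norm]; exact ENNReal.ofReal_le_ofReal (mem_ball_zero_iff.1 hxR).le
    have hxl' : ENNReal.ofReal lam ≤ ‖X t s x‖ₑ := by
      rw [← ofReal_norm]
      exact ENNReal.ofReal_le_ofReal (by simpa using hxl)
    have hfinal := hxl'.trans (hx2.trans (add_le_add_left hxR' _))
    show ENNReal.ofReal (lam - R - N.toReal) ≤ Φ x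
    rw [ENNReal.ofReal_sub _ ENNReal.toReal_nonneg, ENNReal.ofReal_sub _ hR.le,
      ENNReal.ofReal_toReal hNtop, tsub_le_iff_right, tsub_le_iff_left]
    exact hfinal
  have hpos : ENNReal.ofReal (lam - R - N.toReal) ≠ 0 := by
    simp only [ne_eq, ENNReal.ofReal_eq_zero, not_le]; linarith
  rw [ENNReal.le_div_iff_mul_le (.inl hpos) (.inl ENNReal.ofReal_ne_top), mul_comm]
  exact (mul_le_mul_right (measure_mono_ae hsub) _).trans (mul_meas_ge_le_lintegral₀ hΦm _)

end Flows

/-! ### The estimate of the logarithmic functional -/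

section LogEstimate

open Filter

theorem lintegral_restrict_le_eLpNorm_mul {α : Type*} [MeasurableSpace α] {μ : Measure α}
    {m : α → ℝ≥0∞} (hm : Measurable m) {p : ℝ≥0∞} (hp : 1 ≤ p) (s : Set α) :
    ∫⁻ x in s, m x ∂μ ≤ eLpNorm m p μ * μ s ^ (1 - 1 / p.toReal) := by
  have := eLpNorm_le_eLpNorm_mul_rpow_measure_univ (μ := μ.restrict s) hp hm.aestronglyMeasurable
  rw [eLpNorm_one_eq_lintegral_enorm] at this
  simp only [enorm_eq_self, Measure.restrict_apply_univ, ENNReal.toReal_one, div_one] at this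
  refine this.trans ?_
  gcongr
  exact Measure.restrict_le_self

theorem ENNReal.mul_div_add_le (a b c : ℝ≥0∞) : a * c / (a + b) ≤ c := by
  refine ENNReal.div_le_of_le_mul ?_
  rw [mul_comm]
  gcongr
  exact le_self_add

/-- The comparison of two fields along two measure preserving maps. -/
theorem exists_lintegral_ball_enorm_sub_div_le (d : ℕ) (R : ℝ) : ∃ c₂ : ℝ≥0,
    ∀ p : ℝ≥0∞, 1 < p → p < ⊤ → ∃ c₁ : ℝ≥0,
      ∀ (f1 f11 f12 f2 f21 f22 : Rd d → Rd d) (A11 A12 : Rd d → Rd d →L[ℝ] Rd d)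
        (Y1 Y2 : Rd d → Rd d) (δ lam : ℝ),
      0 < δ →
      (∀ᵐ x, f1 x = f11 x + f12 x) → (∀ᵐ x, f2 x = f21 x + f22 x) →
      HasWeakFDeriv f11 A11 → HasWeakFDeriv f12 A12 →
      AEStronglyMeasurable f21 volume → AEStronglyMeasurable f22 volume →
      eLpNorm A11 p volume < ⊤ → eLpNorm A12 ⊤ volume < ⊤ →
      MeasurePreserving Y1 volume volume → MeasurePreserving Y2 volume volume →
      ∫⁻ x in ball (0 : Rd d) R,
          ‖f1 (Y1 x) - f2 (Y2 x)‖ₑ / (‖Y1 x - Y2 x‖ₑ + ENNReal.ofReal δ) ≤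
        c₁ * eLpNorm A11 p volume + c₂ * eLpNorm A12 ⊤ volume +
          (ENNReal.ofReal δ)⁻¹ * eLpNorm (f11 - f21) 1 volume +
          (ENNReal.ofReal δ)⁻¹ * eLpNorm (f12 - f22) 1 (volume.restrict (ball 0 lam)) +
          (ENNReal.ofReal δ)⁻¹ * ((eLpNorm f12 ⊤ volume + eLpNorm f22 ⊤ volume) *
            volume {x | x ∈ ball (0 : Rd d) R ∧ Y2 x ∉ ball 0 lam}) := by
  set B := ball (0 : Rd d) R with hB
  have hBtop : volume B ≠ ⊤ := measure_ball_lt_top.ne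
  refine ⟨4 * 2 ^ d * (volume B).toNNReal, fun p hp1 hp => ?_⟩
  obtain ⟨C, hC⟩ := exists_forall_hasWeakFDeriv_enorm_sub_le d hp1 hp
  set W := volume B ^ (1 - 1 / p.toReal) with hW
  have hWtop : W ≠ ⊤ := by
    refine ENNReal.rpow_ne_top_of_nonneg ?_ hBtop
    have : 1 ≤ p.toReal := by
      rw [← ENNReal.toReal_one]; exact ENNReal.toReal_mono hp.ne hp1.le
    rw [sub_nonneg]
    exact div_le_one_of_le₀ this (by linarith)
  refine ⟨2 * C * W.toNNReal, ?_⟩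
  intro f1 f11 f12 f2 f21 f22 A11 A12 Y1 Y2 δ lam hδ hf1 hf2 h11 h12 h21 h22 hA11 hA12 hY1 hY2
  have hδ0 : ENNReal.ofReal δ ≠ 0 := by simpa using hδ
  obtain ⟨m, hm, hmA, s, hs, hms⟩ := hC f11 A11 h11 hA11
  obtain ⟨s', hs', hms'⟩ := h12.exists_null_enorm_sub_le_of_eLpNorm_top hA12
  have hq1 := hY1.quasiMeasurePreserving
  have hq2 := hY2.quasiMeasurePreserving
  have h11m := h11.locallyIntegrable.aestronglyMeasurable
  have h12m := h12.locallyIntegrable.aestronglyMeasurable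
  set e := (ENNReal.ofReal δ)⁻¹ with he
  have hetop : e ≠ ⊤ := ENNReal.inv_ne_top.2 hδ0
  set a := 4 * 2 ^ d * eLpNorm A12 ⊤ volume with ha
  have hdiv : ∀ b c : ℝ≥0∞, b / (c + ENNReal.ofReal δ) ≤ e * b := fun b c => by
    rw [he, mul_comm, ← div_eq_mul_inv]
    gcongr
    exact le_add_self
  have hpt : ∀ᵐ x, ‖f1 (Y1 x) - f2 (Y2 x)‖ₑ / (‖Y1 x - Y2 x‖ₑ + ENNReal.ofReal δ) ≤
      m (Y1 x) + (m (Y2 x) + (a + (e * ‖(f11 - f21) (Y2 x)‖ₑ + e * ‖(f12 - f22) (Y2 x)‖ₑ))) := by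
    filter_upwards [hq1.ae hf1, hq2.ae hf1, hq2.ae hf2, hq1.ae hs, hq2.ae hs, hq1.ae hs',
      hq2.ae hs'] with x h1 h2 h3 h4 h5 h6 h7
    -- The two fields are compared at `Y2 x`, so that increments between `Y1 x` and `Y2 x` are taken
    -- only of the first field, the one with weak derivatives.
    have hsplit : f1 (Y1 x) - f2 (Y2 x) = (f11 (Y1 x) - f11 (Y2 x)) +
        ((f12 (Y1 x) - f12 (Y2 x)) + ((f11 - f21) (Y2 x) + (f12 - f22) (Y2 x))) := by
      rw [h1, h3, Pi.sub_apply, Pi.sub_apply]; abel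
    have hn : ‖f1 (Y1 x) - f2 (Y2 x)‖ₑ ≤ ‖Y1 x - Y2 x‖ₑ * (m (Y1 x) + m (Y2 x)) +
        (‖Y1 x - Y2 x‖ₑ * a + (‖(f11 - f21) (Y2 x)‖ₑ + ‖(f12 - f22) (Y2 x)‖ₑ)) := by
      rw [hsplit]
      refine (enorm_add_le _ _).trans (add_le_add (hms _ h4 _ h5) ?_)
      refine (enorm_add_le _ _).trans (add_le_add ?_ (enorm_add_le _ _))
      exact (hms' _ h6 _ h7).trans_eq (by rw [ha]; ring)
    refine (ENNReal.div_le_div_right hn _).trans ?_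
    rw [ENNReal.add_div, ENNReal.add_div, ENNReal.add_div, ← add_assoc (m (Y1 x))]
    exact add_le_add (ENNReal.mul_div_add_le _ _ _)
      (add_le_add (ENNReal.mul_div_add_le _ _ _) (add_le_add (hdiv _ _) (hdiv _ _)))
  have hmY : ∀ Y : Rd d → Rd d, MeasurePreserving Y volume volume →
      ∫⁻ x in B, m (Y x) ≤ C * W * eLpNorm A11 p volume := by
    intro Y hY
    refine (lintegral_restrict_le_eLpNorm_mul (hm.comp hY.measurable) hp1.le B).trans ?_
    rw [← hW]
    have : eLpNorm (m ∘ Y) p volume = eLpNorm m p volume :=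
      eLpNorm_comp_measurePreserving hm.aestronglyMeasurable hY
    calc eLpNorm (m ∘ Y) p volume * W ≤ (C * eLpNorm A11 p volume) * W := by rw [this]; gcongr
      _ = _ := by ring
  have hg1 : AEMeasurable (fun x => ‖(f11 - f21) (Y2 x)‖ₑ) volume :=
    ((h11m.sub h21).comp_measurePreserving hY2).enorm
  have hg2 : AEMeasurable (fun x => ‖(f12 - f22) (Y2 x)‖ₑ) volume :=
    ((h12m.sub h22).comp_measurePreserving hY2).enorm
  have hT3 : ∫⁻ x in B, ‖(f11 - f21) (Y2 x)‖ₑ ≤ eLpNorm (f11 - f21) 1 volume := by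
    rw [eLpNorm_one_eq_lintegral_enorm,
      ← hY2.lintegral_comp_of_aemeasurable (h11m.sub h21).enorm]
    exact setLIntegral_le_lintegral _ _
  set S := Y2 ⁻¹' ball 0 lam with hS
  have hSm : MeasurableSet S := hY2.measurable measurableSet_ball
  have hT4 : ∫⁻ x in B, ‖(f12 - f22) (Y2 x)‖ₑ ≤
      eLpNorm (f12 - f22) 1 (volume.restrict (ball 0 lam)) +
        (eLpNorm f12 ⊤ volume + eLpNorm f22 ⊤ volume) *
          volume {x | x ∈ B ∧ Y2 x ∉ ball 0 lam} := by
    -- On `S` the image lies in `ball 0 lam`, and the local `L^1` norm suffices; off `S` the sup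
    -- norms are multiplied by the measure of the escaping points.
    rw [← lintegral_inter_add_sdiff _ B hSm]
    gcongr
    · rw [eLpNorm_one_eq_lintegral_enorm, ← (hY2.restrict_preimage
        measurableSet_ball).lintegral_comp_of_aemeasurable (h12m.sub h22).restrict.enorm]
      exact lintegral_mono_set inter_subset_right
    · have hb : ∀ᵐ x, ‖(f12 - f22) x‖ₑ ≤ eLpNorm f12 ⊤ volume + eLpNorm f22 ⊤ volume := by
        simp_rw [eLpNorm_exponent_top]
        filter_upwards [ae_le_eLpNormEssSup (f := f12) (μ := volume),
          ae_le_eLpNormEssSup (f := f22) (μ := volume)] with x h1 h2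
        exact enorm_sub_le.trans (add_le_add h1 h2)
      calc ∫⁻ x in B \ S, ‖(f12 - f22) (Y2 x)‖ₑ
          ≤ ∫⁻ _ in B \ S, (eLpNorm f12 ⊤ volume + eLpNorm f22 ⊤ volume) :=
            lintegral_mono_ae (ae_restrict_of_ae (hq2.ae hb))
        _ = _ := by
            rw [lintegral_const, Measure.restrict_apply_univ]
            rfl
  calc ∫⁻ x in B, ‖f1 (Y1 x) - f2 (Y2 x)‖ₑ / (‖Y1 x - Y2 x‖ₑ + ENNReal.ofReal δ)
      ≤ ∫⁻ x in B, (m (Y1 x) + (m (Y2 x) + (a + (e * ‖(f11 - f21) (Y2 x)‖ₑ +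
          e * ‖(f12 - f22) (Y2 x)‖ₑ)))) := lintegral_mono_ae (ae_restrict_of_ae hpt)
    _ = (∫⁻ x in B, m (Y1 x)) + ((∫⁻ x in B, m (Y2 x)) + (a * volume B +
          (e * (∫⁻ x in B, ‖(f11 - f21) (Y2 x)‖ₑ) +
            e * ∫⁻ x in B, ‖(f12 - f22) (Y2 x)‖ₑ))) := by
        have hm1 : Measurable fun x => m (Y1 x) := hm.comp hY1.measurable
        have hm2 : Measurable fun x => m (Y2 x) := hm.comp hY2.measurable
        rw [lintegral_add_left hm1, lintegral_add_left hm2,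
          lintegral_add_left measurable_const, lintegral_add_left' (hg1.restrict.const_mul e),
          lintegral_const_mul' _ _ hetop, lintegral_const_mul' _ _ hetop, setLIntegral_const]
    _ ≤ C * W * eLpNorm A11 p volume + (C * W * eLpNorm A11 p volume + (a * volume B +
          (e * eLpNorm (f11 - f21) 1 volume +
            e * (eLpNorm (f12 - f22) 1 (volume.restrict (ball 0 lam)) +
              (eLpNorm f12 ⊤ volume + eLpNorm f22 ⊤ volume) *
                volume {x | x ∈ B ∧ Y2 x ∉ ball 0 lam})))) := by
        gcongr
        · exact hmY Y1 hY1
        · exact hmY Y2 hY2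
    _ = _ := by
        push_cast
        rw [ENNReal.coe_toNNReal hBtop, ENNReal.coe_toNNReal hWtop, ha]
        ring

/-- The estimate of the logarithmic functional of two regular Lagrangian flows. -/
theorem exists_iSup_logFunctional_le (d : ℕ) (R : ℝ) (hR : 0 < R) :
    ∃ c₂ : ℝ≥0, ∀ p : ℝ≥0∞, 1 < p → p < ⊤ → ∃ c₁ : ℝ≥0,
      ∀ (T : ℝ), 0 < T →
        ∀ (b1 b11 b12 b2 b21 b22 : ℝ → Rd d → Rd d) (D11 D12 : ℝ → Rd d → Rd d →L[ℝ] Rd d)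
          (X1 X2 : ℝ → ℝ → Rd d → Rd d),
        IsFlowPair p T b1 b11 b12 b2 b21 b22 D11 D12 X1 X2 →
        ∀ δ : ℝ, 0 < δ → ∀ lam : ℝ, R + (L1LqNorm T ⊤ volume b22).toReal < lam →
          (⨆ t ∈ Icc 0 T, ⨆ s ∈ Icc 0 T, logFunctional δ R X1 X2 t s) ≤
            c₁ * L1LqNorm T p volume D11 + c₂ * L1LqNorm T ⊤ volume D12
            + (ENNReal.ofReal δ)⁻¹ * L1LqNorm T 1 volume (b11 - b21)
            + (ENNReal.ofReal δ)⁻¹ * L1LqNorm T 1 (volume.restrict (ball 0 lam)) (b12 - b22)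
            + (ENNReal.ofReal δ)⁻¹
              * ((L1LqNorm T ⊤ volume b12 + L1LqNorm T ⊤ volume b22)
                / ENNReal.ofReal (lam - R - (L1LqNorm T ⊤ volume b22).toReal))
              * L1LqNorm T 1 volume b21 := by
  obtain ⟨c₂, hc₂⟩ := exists_lintegral_ball_enorm_sub_div_le d R
  refine ⟨c₂, fun p hp1 hp => ?_⟩
  obtain ⟨c₁, hc⟩ := hc₂ p hp1 hp
  refine ⟨c₁, ?_⟩
  intro T hT b1 b11 b12 b2 b21 b22 D11 D12 X1 X2 h δ hδ lam hlam
  refine iSup₂_le fun t ht => iSup₂_le fun s hs => ?_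
  have hδ0 : ENNReal.ofReal δ ≠ 0 := by simpa using hδ
  set e := (ENNReal.ofReal δ)⁻¹ with he
  have hetop : e ≠ ⊤ := ENNReal.inv_ne_top.2 hδ0
  -- This bounds the measure of the escaping points uniformly in `τ`, so it factors out of the time
  -- integral.
  set q := L1LqNorm T 1 volume b21 /
    ENNReal.ofReal (lam - R - (L1LqNorm T ⊤ volume b22).toReal) with hq
  set V : Rd d → ℝ → ℝ≥0∞ := fun x τ => ‖b1 τ (X1 τ s x) - b2 τ (X2 τ s x)‖ₑ /
    (‖X1 τ s x - X2 τ s x‖ₑ + ENNReal.ofReal δ) with hV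
  have hXm : ∀ {u : ℝ → Rd d → Rd d} {X : ℝ → ℝ → Rd d → Rd d}, IsRegularLagrangianFlow T u X →
      Measurable fun z : Rd d × ℝ => X z.2 s z.1 := fun hX =>
    hX.measurable.comp (f := fun z : Rd d × ℝ => (z.2, s, z.1)) (by fun_prop)
  have hbm : ∀ {u : ℝ → Rd d → Rd d} {X : ℝ → ℝ → Rd d → Rd d}, IsIncompressibleField T u →
      IsRegularLagrangianFlow T u X → Measurable fun z : Rd d × ℝ => u z.2 (X z.2 s z.1) :=
    fun hu hX => hu.measurable.comp (measurable_snd.prodMk (hXm hX))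
  have hVm : Measurable (Function.uncurry V) :=
    ((hbm h.incompressible_b1 h.flow_X1).sub (hbm h.incompressible_b2 h.flow_X2)).enorm.div
      (((hXm h.flow_X1).sub (hXm h.flow_X2)).enorm.add measurable_const)
  have hlog : logFunctional δ R X1 X2 t s ≤
      ∫⁻ τ in Icc 0 T, ∫⁻ x in ball (0 : Rd d) R, V x τ := by
    rw [← lintegral_lintegral_swap hVm.aemeasurable]
    refine lintegral_mono_ae (ae_restrict_of_ae ?_)
    filter_upwards [h.flow_X1.integrable s hs, h.flow_X2.integrable s hs,
      h.flow_X1.integral_eq s hs, h.flow_X2.integral_eq s hs] with x h1 h2 h3 h4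
    exact ofReal_log_norm_sub_le hδ hT.le hs ht h1 h2 h3 h4
  have hN11 := aemeasurable_eLpNorm_slice h.mem_D11.1 p
  have hN12 := aemeasurable_eLpNorm_slice h.mem_D12.1 ⊤
  have hNb12 := aemeasurable_eLpNorm_slice h.mem_b12.1 ⊤
  have hN1 := aemeasurable_eLpNorm_slice (f := b11 - b21) (h.mem_b11.1.sub h.mem_b21.1) 1
  have hN2 : AEMeasurable (fun τ => eLpNorm ((b12 - b22) τ) 1 (volume.restrict (ball 0 lam)))
      (volume.restrict (Icc 0 T)) := by
    refine aemeasurable_eLpNorm_slice (f := b12 - b22) (AEStronglyMeasurable.mono_measure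
      (h.mem_b12.1.sub h.mem_b22.1) ?_) 1
    exact Measure.prod_mono le_rfl Measure.restrict_le_self
  have hslice : ∀ᵐ τ ∂(volume.restrict (Icc 0 T)), ∫⁻ x in ball (0 : Rd d) R, V x τ ≤
      c₁ * eLpNorm (D11 τ) p volume + c₂ * eLpNorm (D12 τ) ⊤ volume +
        e * eLpNorm ((b11 - b21) τ) 1 volume +
        e * eLpNorm ((b12 - b22) τ) 1 (volume.restrict (ball 0 lam)) +
        e * ((eLpNorm (b12 τ) ⊤ volume + eLpNorm (b22 τ) ⊤ volume) * q) := by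
    filter_upwards [Measure.ae_ae_of_ae_prod h.b1_eq, Measure.ae_ae_of_ae_prod h.b2_eq,
      h.hasWeakFDeriv_b11, h.hasWeakFDeriv_b12, h.mem_b21.1.prodMk_left, h.mem_b22.1.prodMk_left,
      ae_lt_top' hN11 h.mem_D11.2.ne, ae_lt_top' hN12 h.mem_D12.2.ne,
      ae_restrict_mem measurableSet_Icc] with τ h1 h2 h3 h4 h5 h6 h7 h8 hτ
    refine (hc (b1 τ) (b11 τ) (b12 τ) (b2 τ) (b21 τ) (b22 τ) (D11 τ) (D12 τ) (X1 τ s) (X2 τ s)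
      δ lam hδ h1 h2 h3 h4 h5 h6 h7 h8 (h.flow_X1.measurePreserving s hs τ hτ)
      (h.flow_X2.measurePreserving s hs τ hτ)).trans ?_
    gcongr
    · exact le_rfl
    · exact le_rfl
    · exact h.flow_X2.measure_ball_inter_le h.b2_eq h.mem_b21 h.mem_b22 hs hτ hR hlam
  calc logFunctional δ R X1 X2 t s
      ≤ ∫⁻ τ in Icc 0 T, ∫⁻ x in ball (0 : Rd d) R, V x τ := hlog
    _ ≤ ∫⁻ τ in Icc 0 T, (c₁ * eLpNorm (D11 τ) p volume + c₂ * eLpNorm (D12 τ) ⊤ volume +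
          e * eLpNorm ((b11 - b21) τ) 1 volume +
          e * eLpNorm ((b12 - b22) τ) 1 (volume.restrict (ball 0 lam)) +
          e * ((eLpNorm (b12 τ) ⊤ volume + eLpNorm (b22 τ) ⊤ volume) * q)) :=
        lintegral_mono_ae hslice
    _ = c₁ * L1LqNorm T p volume D11 + c₂ * L1LqNorm T ⊤ volume D12
          + e * L1LqNorm T 1 volume (b11 - b21)
          + e * L1LqNorm T 1 (volume.restrict (ball 0 lam)) (b12 - b22)
          + e * ((L1LqNorm T ⊤ volume b12 + L1LqNorm T ⊤ volume b22) * q) := by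
        have hqtop : q ≠ ⊤ := ENNReal.div_ne_top h.mem_b21.2.ne (by
          simp only [ne_eq, ENNReal.ofReal_eq_zero, not_le]; linarith)
        simp only [add_assoc]
        rw [lintegral_add_left' (hN11.const_mul _), lintegral_add_left' (hN12.const_mul _),
          lintegral_add_left' (hN1.const_mul _), lintegral_add_left' (hN2.const_mul _),
          lintegral_const_mul' _ _ ENNReal.coe_ne_top,
          lintegral_const_mul' _ _ ENNReal.coe_ne_top, lintegral_const_mul' _ _ hetop,
          lintegral_const_mul' _ _ hetop, lintegral_const_mul' _ _ hetop,
          lintegral_mul_const' _ _ hqtop, lintegral_add_left' hNb12]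
        rfl
    _ = _ := by
        rw [hq]
        simp only [div_eq_mul_inv]
        ring

end LogEstimate

/-! ### Markov's inequality and the choice of parameters -/

section Stability

/-- Markov's inequality for the logarithmic functional. -/
theorem ofReal_log_mul_measure_le_logFunctional {d : ℕ} {δ R ε : ℝ} (hδ : 0 < δ) (hε : 0 < ε)
    {X1 X2 : ℝ → ℝ → Rd d → Rd d} {t s : ℝ} (h1 : Measurable (X1 t s)) (h2 : Measurable (X2 t s)) :
    ENNReal.ofReal (Real.log (ε / δ + 1)) *
        volume {x : Rd d | x ∈ ball 0 R ∧ ε < ‖X1 t s x - X2 t s x‖} ≤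
      logFunctional δ R X1 X2 t s := by
  have hm : Measurable fun x => ENNReal.ofReal (Real.log (‖X1 t s x - X2 t s x‖ / δ + 1)) := by
    fun_prop
  refine le_trans ?_ (mul_meas_ge_le_lintegral₀ hm.aemeasurable
    (ENNReal.ofReal (Real.log (ε / δ + 1))))
  rw [Measure.restrict_apply' measurableSet_ball]
  gcongr
  rintro x ⟨hx, hxε⟩
  refine ⟨?_, hx⟩
  show ENNReal.ofReal _ ≤ ENNReal.ofReal _
  gcongr

/-- All parameters are fixed from the bounds `K` and `A` before any flow is given, which makes `C`
and `lam` uniform. After division by `L = log (ε / δ + 1)`, the derivative term and the exit term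
each take `η / 2`. -/
theorem exists_measure_lt_le_of_logFunctional_le (d : ℕ) {R ε η : ℝ} (hε : 0 < ε)
    (hη : 0 < η) (K A : ℝ≥0) : ∃ C : ℝ≥0, ∃ δ : ℝ, 0 < δ ∧ ∃ lam : ℝ, R + K < lam ∧
      ∀ (X1 X2 : ℝ → ℝ → Rd d → Rd d) (t s : ℝ), Measurable (X1 t s) → Measurable (X2 t s) →
      ∀ (N : ℝ) (D : ℝ≥0∞), N ≤ K →
      logFunctional δ R X1 X2 t s ≤ A + (ENNReal.ofReal δ)⁻¹ * D +
        (ENNReal.ofReal δ)⁻¹ * ((K + K) / ENNReal.ofReal (lam - R - N)) * K →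
      volume {x : Rd d | x ∈ ball 0 R ∧ ε < ‖X1 t s x - X2 t s x‖} ≤
        C * D + ENNReal.ofReal η := by
  -- This gives `A ≤ L * η / 2`; the added 1 keeps `L` positive when `A = 0`.
  set L : ℝ := 2 * A / η + 1 with hL
  have hL0 : 0 < L := by positivity
  have hexp : 0 < Real.exp L - 1 := by linarith [Real.add_one_lt_exp hL0.ne']
  -- The solution of `log (ε / δ + 1) = L`.
  set δ : ℝ := ε / (Real.exp L - 1) with hδdef
  have hδ : 0 < δ := by positivity
  have hlog : Real.log (ε / δ + 1) = L := by
    have : ε / δ = Real.exp L - 1 := by rw [hδdef]; field_simp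
    rw [this, sub_add_cancel, Real.log_exp]
  -- `Λ` is a lower bound for `lam - R - N` when `lam = R + K + Λ` and `N ≤ K`; its size brings the
  -- exit term below `L * η / 2`.
  set Λ : ℝ := 4 * K * K / (δ * L * η) + 1 with hΛ
  have hΛ0 : 0 < Λ := by positivity
  have hAL : (A : ℝ) ≤ L * η / 2 := by
    have : L * η / 2 = A + η / 2 := by rw [hL]; field_simp
    linarith
  have hKL : δ⁻¹ * ((K + K) / Λ) * K ≤ L * η / 2 := by
    have h1 : 4 * K * K / (δ * L * η) ≤ Λ := by linarith
    rw [div_le_iff₀ (by positivity)] at h1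
    have h2 : δ⁻¹ * ((K + K) / Λ) * K = (4 * K * K) / (2 * δ * Λ) := by field_simp; ring
    rw [h2, div_le_iff₀ (by positivity)]
    linarith
  refine ⟨(δ⁻¹ * L⁻¹).toNNReal, δ, hδ, R + K + Λ, by linarith, ?_⟩
  intro X1 X2 t s h1 h2 N D hN hlogF
  have hmarkov := (ofReal_log_mul_measure_le_logFunctional hδ hε h1 h2).trans hlogF
  rw [hlog] at hmarkov
  have hlast : (ENNReal.ofReal δ)⁻¹ * ((K + K) / ENNReal.ofReal (R + K + Λ - R - N)) * K ≤
      ENNReal.ofReal (L * η / 2) := by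
    calc _ ≤ (ENNReal.ofReal δ)⁻¹ * ((K + K) / ENNReal.ofReal Λ) * K := by
          gcongr; linarith
      _ = ENNReal.ofReal (δ⁻¹ * ((K + K) / Λ) * K) := by
          rw [ENNReal.ofReal_mul (by positivity), ENNReal.ofReal_mul (by positivity),
            ENNReal.ofReal_div_of_pos hΛ0, ENNReal.ofReal_add K.coe_nonneg K.coe_nonneg,
            ENNReal.ofReal_coe_nnreal, ENNReal.ofReal_inv_of_pos hδ]
      _ ≤ _ := ENNReal.ofReal_le_ofReal hKL
  have hfirst : (A : ℝ≥0∞) ≤ ENNReal.ofReal (L * η / 2) := by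
    rw [← ENNReal.ofReal_coe_nnreal]; exact ENNReal.ofReal_le_ofReal hAL
  have hsum : ENNReal.ofReal L *
      volume {x : Rd d | x ∈ ball 0 R ∧ ε < ‖X1 t s x - X2 t s x‖} ≤
      (ENNReal.ofReal δ)⁻¹ * D + ENNReal.ofReal L * ENNReal.ofReal η := by
    refine (hmarkov.trans (add_le_add (add_le_add_left hfirst _) hlast)).trans_eq ?_
    rw [add_right_comm, ← ENNReal.ofReal_add (by positivity) (by positivity), add_halves,
      ENNReal.ofReal_mul hL0.le, add_comm]
  have hL0' : ENNReal.ofReal L ≠ 0 := by simpa using hL0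
  have hC : ((δ⁻¹ * L⁻¹).toNNReal : ℝ≥0∞) =
      (ENNReal.ofReal L)⁻¹ * (ENNReal.ofReal δ)⁻¹ := by
    rw [← ENNReal.ofReal_inv_of_pos hδ, ← ENNReal.ofReal_inv_of_pos hL0,
      ← ENNReal.ofReal_mul (by positivity), mul_comm]
    rfl
  rw [hC]
  refine (ENNReal.mul_le_mul_iff_right hL0' ENNReal.ofReal_ne_top).1 (hsum.trans_eq ?_)
  rw [mul_add, ← mul_assoc, ← mul_assoc, ENNReal.mul_inv_cancel hL0' ENNReal.ofReal_ne_top, one_mul]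

end Stability

/-! ### The main theorem -/

/-- The order of the quantifiers encodes the dependence of the constants: `c₂` is chosen before `p`,
and `C` and `lam` before the time horizon, the fields and the flows. -/
theorem theoremA1 (d : ℕ) (R : ℝ) (hR : 0 < R) :
    ∃ c₂ : ℝ≥0, ∀ p : ℝ≥0∞, 1 < p → p < ⊤ → ∃ c₁ : ℝ≥0,
      (∀ (T : ℝ), 0 < T →
        ∀ (b1 b11 b12 b2 b21 b22 : ℝ → Rd d → Rd d) (D11 D12 : ℝ → Rd d → Rd d →L[ℝ] Rd d)
          (X1 X2 : ℝ → ℝ → Rd d → Rd d),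
        IsFlowPair p T b1 b11 b12 b2 b21 b22 D11 D12 X1 X2 →
        ∀ δ : ℝ, 0 < δ → ∀ lam : ℝ, R + (L1LqNorm T ⊤ volume b22).toReal < lam →
          (⨆ t ∈ Icc 0 T, ⨆ s ∈ Icc 0 T, logFunctional δ R X1 X2 t s) ≤
            c₁ * L1LqNorm T p volume D11 + c₂ * L1LqNorm T ⊤ volume D12
            + (ENNReal.ofReal δ)⁻¹ * L1LqNorm T 1 volume (b11 - b21)
            + (ENNReal.ofReal δ)⁻¹ * L1LqNorm T 1 (volume.restrict (ball 0 lam)) (b12 - b22)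
            + (ENNReal.ofReal δ)⁻¹
              * ((L1LqNorm T ⊤ volume b12 + L1LqNorm T ⊤ volume b22)
                / ENNReal.ofReal (lam - R - (L1LqNorm T ⊤ volume b22).toReal))
              * L1LqNorm T 1 volume b21) ∧
      (∀ ε η : ℝ, 0 < ε → 0 < η → ∀ K : ℝ≥0, ∃ C : ℝ≥0, ∃ lam : ℝ, 0 < lam ∧
        ∀ (T : ℝ), 0 < T →
        ∀ (b1 b11 b12 b2 b21 b22 : ℝ → Rd d → Rd d) (D11 D12 : ℝ → Rd d → Rd d →L[ℝ] Rd d)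
          (X1 X2 : ℝ → ℝ → Rd d → Rd d),
        IsFlowPair p T b1 b11 b12 b2 b21 b22 D11 D12 X1 X2 →
        L1LqNorm T 1 volume b11 ≤ K → L1LqNorm T ⊤ volume b12 ≤ K →
        L1LqNorm T 1 volume b21 ≤ K → L1LqNorm T ⊤ volume b22 ≤ K →
        L1LqNorm T p volume D11 ≤ K → L1LqNorm T ⊤ volume D12 ≤ K →
          (⨆ t ∈ Icc 0 T, ⨆ s ∈ Icc 0 T,
            volume {x : Rd d | x ∈ ball 0 R ∧ ε < ‖X1 t s x - X2 t s x‖}) ≤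
            C * (L1LqNorm T 1 volume (b11 - b21)
              + L1LqNorm T 1 (volume.restrict (ball 0 lam)) (b12 - b22))
            + ENNReal.ofReal η) := by
  obtain ⟨c₂, hc₂⟩ := exists_iSup_logFunctional_le d R hR
  refine ⟨c₂, fun p hp1 hp => ?_⟩
  obtain ⟨c₁, hc⟩ := hc₂ p hp1 hp
  refine ⟨c₁, hc, fun ε η hε hη K => ?_⟩
  -- The two derivative terms together are at most `c₁ * K + c₂ * K`, independently of `δ` and
  -- `lam`.
  obtain ⟨C, δ, hδ, lam, hlam, hstab⟩ :=
    exists_measure_lt_le_of_logFunctional_le d (R := R) hε hη K (c₁ * K + c₂ * K)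
  refine ⟨C, lam, lt_trans (by positivity) hlam, ?_⟩
  intro T hT b1 b11 b12 b2 b21 b22 D11 D12 X1 X2 h _ hb12 hb21 hb22 hD11 hD12
  have hN : (L1LqNorm T ⊤ volume b22).toReal ≤ K := ENNReal.toReal_le_coe_of_le_coe hb22
  have hlog := hc T hT b1 b11 b12 b2 b21 b22 D11 D12 X1 X2 h δ hδ lam (by linarith)
  refine iSup₂_le fun t ht => iSup₂_le fun s hs => ?_
  refine hstab X1 X2 t s (h.flow_X1.measurePreserving s hs t ht).measurable
    (h.flow_X2.measurePreserving s hs t ht).measurable _ _ hN ?_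
  refine ((le_iSup₂_of_le t ht (le_iSup₂_of_le (f := fun s _ => logFunctional δ R X1 X2 t s) s hs le_rfl)).trans hlog).trans ?_
  rw [mul_add, ← add_assoc]
  push_cast
  gcongr
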